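/- Let $\Gamma$ be a group, $\Gamma_1$ a normal subgroup of $\Gamma$, and $\mathcal A$ a set of subgroups of $\Gamma$ such that every non-identity element of $\Gamma$ lies in exactly one member of $\{\Gamma_1\}\cup\mathcal A$, every $A\in\mathcal A$ is malnormal ($g^{-1}Ag\cap A=\{1\}$ for all $g\in\Gamma\setminus A$), and every conjugate of a member of $\mathcal A$ is in $\mathcal A$. A $\Gamma$-gain graph $(G,\psi)$ is a finite multigraph $G$ (loops and parallel edges allowed) with a value $\psi(e,u,v)\in\Gamma$ for every oriented edge $(e,u,v)$, such that $\psi(e,u,v)=\psi(e,v,u)^{-1}$ if $u\neq v$. A cycle is $\psi$-balanced if the ordered product of the gains along some simple closed walk around it is $1$. The frame matroid $F(G,\psi)$ is the matroid on $E(G)$ whose circuits are the (edge sets of) balanced cycles, and of theta graphs and tight or loose handcuffs all of whose cycles are unbalanced. Let $\psi/\Gamma_1$ be the $(\Gamma/\Gamma_1)$-gain function induced by $\psi$, and let $\mathcal C=\mathcal C(\Gamma,\Gamma_1,\mathcal A,G,\psi)$ be the set of circuits $C$ of $F(G,\psi/\Gamma_1)$ such that $C$ is a $\psi$-balanced cycle,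 or $C$ is a handcuff or theta graph for which there are $\eta\colon V(G)\to\Gamma$ and $A\in\mathcal A$ with $\eta(u)^{-1}\psi(e,u,v)\eta(v)\in A$ for every orientation $(e,u,v)$ of every $e\in C$. Let $M(\Gamma,\Gamma_1,\mathcal A,G,\psi)$ be the matroid on $E(G)$ in which the rank of $X$ is its rank in $F(G,\psi/\Gamma_1)$ if every circuit of $F(G,\psi/\Gamma_1)$ contained in $X$ is in $\mathcal C$, and is that rank plus one otherwise. Let $\mathcal M(\Gamma,\Gamma_1,\mathcal A)$ be the class of matroids isomorphic to $M(\Gamma,\Gamma_1,\mathcal A,G,\psi)$ for some $\Gamma$-gain graph $(G,\psi)$. For an integer $r\ge 3$, an $r$-spike is a simple rank-$r$ matroid on $2r+1$ elements with an element $t$ (a tip) and $r$ distinct three-element lines (rank-$2$ flats) through $t$ such that, for all $1\le k\le r-1$, the union of any $k$ of these lines has rank $k+1$. Proposition. If $\Gamma_1$ is nontrivial, then: 1. $\mathcal M(\Gamma,\Gamma_1,\mathcal A)$ is not closed under direct sums; 2. $\mathcal M(\Gamma,\Gamma_1,\mathcal A)$ contains an $r$-spike for every integer $r\ge 3$; 3.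 if $M$ is an $r$-spike in $\mathcal M(\Gamma,\Gamma_1,\mathcal A)$ with $r\ge 5$, then $M\oplus M$ is not in $\mathcal M(\Gamma,\Gamma_1,\mathcal A)$. -/

import Mathlib

open scoped Graph

universe u v w

namespace GainMatroid

section Walks

variable {V : Type u} {E : Type v}

/-- A walk in a multigraph, recorded as an alternating sequence of vertices and edges. -/
inductive GWalk (G : Graph V E) : V → V → Type (max u v)
  | nil {x : V} (hx : x ∈ V(G)) : GWalk G x x
  | cons {x y z : V} (e : E) (h : G.IsLink e x y) (p : GWalk G y z) : GWalk G x z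

namespace GWalk

variable {G : Graph V E}

/-- The list of edges traversed by a walk. -/
def edges : {x y : V} → GWalk G x y → List E
  | _, _, .nil _ => []
  | _, _, .cons e _ p => e :: p.edges

/-- The list of vertices visited by a walk, including both ends. -/
def support : {x y : V} → GWalk G x y → List V
  | x, _, .nil _ => [x]
  | x, _, .cons _ _ p => x :: p.support

/-- The set of edges of a walk. -/
def edgeSet {x y : V} (p : GWalk G x y) : Set E := {e | e ∈ p.edges}

/-- The set of vertices of a walk. -/
def vertexSet {x y : V} (p : GWalk G x y) : Set V := {z | z ∈ p.support}

/-- A path is a walk that repeats no vertex. -/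
def IsPath {x y : V} (p : GWalk G x y) : Prop := p.support.Nodup

/-- A simple closed walk: it has at least one edge, repeats no edge, and repeats no vertex
except that it returns to its start. Loops (one edge) and digons (two edges) are allowed. -/
def IsSimpleClosed {x : V} (p : GWalk G x x) : Prop :=
  p.edges ≠ [] ∧ p.edges.Nodup ∧ p.support.tail.Nodup

end GWalk

/-- The set of vertices incident with an edge in `X`. -/
def edgeVertices (G : Graph V E) (X : Set E) : Set V := {x | ∃ e ∈ X, G.Inc e x}

/-- `C` is the edge set of a cycle of `G`. -/
def IsCycleSet (G : Graph V E) (C : Set E) : Prop :=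
  ∃ (x : V) (p : GWalk G x x), p.IsSimpleClosed ∧ p.edgeSet = C

/-- `C` is the edge set of a theta subgraph: three paths with the same two distinct ends, with
no edges and no further vertices in common. -/
def IsTheta (G : Graph V E) (C : Set E) : Prop :=
  ∃ (x y : V) (p : Fin 3 → GWalk G x y), x ≠ y ∧ (∀ i, (p i).IsPath) ∧
    (∀ i j, i ≠ j → Disjoint (p i).edgeSet (p j).edgeSet ∧
      (p i).vertexSet ∩ (p j).vertexSet = {x, y}) ∧
    C = ⋃ i, (p i).edgeSet

/-- `C` is the edge set of a tight handcuff: two edge-disjoint cycles with exactly one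
common vertex. -/
def IsTightHandcuff (G : Graph V E) (C : Set E) : Prop :=
  ∃ C₁ C₂ : Set E, IsCycleSet G C₁ ∧ IsCycleSet G C₂ ∧ Disjoint C₁ C₂ ∧
    (∃ x, edgeVertices G C₁ ∩ edgeVertices G C₂ = {x}) ∧ C = C₁ ∪ C₂

/-- `C` is the edge set of a loose handcuff: two vertex-disjoint cycles with a minimal path
connecting them. -/
def IsLooseHandcuff (G : Graph V E) (C : Set E) : Prop :=
  ∃ (C₁ C₂ : Set E) (x y : V) (p : GWalk G x y), IsCycleSet G C₁ ∧ IsCycleSet G C₂ ∧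
    Disjoint (edgeVertices G C₁) (edgeVertices G C₂) ∧ p.IsPath ∧
    p.vertexSet ∩ edgeVertices G C₁ = {x} ∧ p.vertexSet ∩ edgeVertices G C₂ = {y} ∧
    C = C₁ ∪ C₂ ∪ p.edgeSet

/-- `C` is the edge set of a (tight or loose) handcuff. -/
def IsHandcuff (G : Graph V E) (C : Set E) : Prop :=
  IsTightHandcuff G C ∨ IsLooseHandcuff G C

end Walks

section Gains

variable {V : Type u} {E : Type v} {Γ : Type w} [Group Γ]

/-- A `Γ`-gain function on `G`: a value in `Γ` for each oriented edge `(e, x, y)`, inverted when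
a non-loop edge is reversed. Only the values at triples with `G.IsLink e x y` matter. -/
structure GainFunction (G : Graph V E) (Γ : Type w) [Group Γ] where
  val : E → V → V → Γ
  val_reverse : ∀ e x y, G.IsLink e x y → x ≠ y → val e x y = (val e y x)⁻¹

variable {G : Graph V E}

namespace GainFunction

/-- The gain of a walk: the product of the gains of its oriented edges, in order. -/
def walkGain (ψ : GainFunction G Γ) : {x y : V} → GWalk G x y → Γ
  | _, _, .nil _ => 1
  | _, _, .cons (x := x) (y := y) e _ p => ψ.val e x y * ψ.walkGain p

/-- The gain function obtained from `ψ` by applying the switching function `η`. -/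
def switch (ψ : GainFunction G Γ) (η : V → Γ) : GainFunction G Γ where
  val e x y := (η x)⁻¹ * ψ.val e x y * η y
  val_reverse e x y h hxy := by rw [ψ.val_reverse e x y h hxy]; group

/-- The `(Γ ⧸ Γ₁)`-gain function induced by `ψ`. -/
def quot (ψ : GainFunction G Γ) (Γ₁ : Subgroup Γ) [Γ₁.Normal] : GainFunction G (Γ ⧸ Γ₁) where
  val e x y := (ψ.val e x y : Γ ⧸ Γ₁)
  val_reverse e x y h hxy := by rw [ψ.val_reverse e x y h hxy]; rfl

/-- The set of all gains of orientations of edges in `X`. -/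
def gainSet (ψ : GainFunction G Γ) (X : Set E) : Set Γ :=
  {g | ∃ e ∈ X, ∃ x y, G.IsLink e x y ∧ ψ.val e x y = g}

/-- `C` is (the edge set of) a `ψ`-balanced cycle. -/
def IsBalancedCycle (ψ : GainFunction G Γ) (C : Set E) : Prop :=
  ∃ (x : V) (p : GWalk G x x), p.IsSimpleClosed ∧ p.edgeSet = C ∧ ψ.walkGain p = 1

/-- The circuits of the frame matroid of `(G, ψ)`: balanced cycles, and handcuffs and theta
graphs all of whose cycles are unbalanced. -/
def IsFrameCircuit (ψ : GainFunction G Γ) (C : Set E) : Prop :=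
  ψ.IsBalancedCycle C ∨
    ((IsHandcuff G C ∨ IsTheta G C) ∧ ∀ D ⊆ C, IsCycleSet G D → ¬ ψ.IsBalancedCycle D)

/-- `N` is the frame matroid `F(G, ψ)`: the matroid on `E(G)` with the circuits above. -/
def IsFrameMatroid (ψ : GainFunction G Γ) (N : Matroid E) : Prop :=
  N.E = E(G) ∧ ∀ C, N.IsCircuit C ↔ ψ.IsFrameCircuit C

/-- The frame matroid of a gain graph is determined by the gain graph. -/
theorem IsFrameMatroid.unique {ψ : GainFunction G Γ} {N N' : Matroid E}
    (h : ψ.IsFrameMatroid N) (h' : ψ.IsFrameMatroid N') : N = N' :=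
  Matroid.ext_isCircuit (h.1.trans h'.1.symm) fun C _ => (h.2 C).trans (h'.2 C).symm

/-- The linear class `𝒞(Γ, Γ₁, 𝒜, G, ψ)` of circuits of `F(G, ψ/Γ₁)`. -/
def linearClass (ψ : GainFunction G Γ) (Γ₁ : Subgroup Γ) [Γ₁.Normal] (𝒜 : Set (Subgroup Γ)) :
    Set (Set E) :=
  {C | (ψ.quot Γ₁).IsFrameCircuit C ∧
    (ψ.IsBalancedCycle C ∨
      ((IsHandcuff G C ∨ IsTheta G C) ∧
        ∃ η : V → Γ, ∃ A ∈ 𝒜, (ψ.switch η).gainSet C ⊆ (A : Set Γ)))}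

end GainFunction

/-- `M` is the elementary lift of `N` given by the set `𝒞` of circuits of `N`: the rank of a set
`X` goes up by one exactly when some circuit of `N` inside `X` is not in `𝒞`. -/
def IsLiftBy (N : Matroid E) (𝒞 : Set (Set E)) (M : Matroid E) : Prop :=
  M.E = N.E ∧ ∀ X ⊆ N.E,
    ((∀ C ⊆ X, N.IsCircuit C → C ∈ 𝒞) → M.eRk X = N.eRk X) ∧
    ((¬ ∀ C ⊆ X, N.IsCircuit C → C ∈ 𝒞) → M.eRk X = N.eRk X + 1)

/-- On a finite ground set, the elementary lift is determined by `N` and `𝒞`. -/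
theorem IsLiftBy.unique {N M M' : Matroid E} {𝒞 : Set (Set E)} (hN : N.E.Finite)
    (h : IsLiftBy N 𝒞 M) (h' : IsLiftBy N 𝒞 M') : M = M' := by
  refine Matroid.ext_indep (h.1.trans h'.1.symm) fun I hI => ?_
  have hI' : I ⊆ N.E := h.1 ▸ hI
  have hfin : I.Finite := hN.subset hI'
  have hr : M.eRk I = M'.eRk I := by
    by_cases hc : ∀ C ⊆ I, N.IsCircuit C → C ∈ 𝒞
    · rw [(h.2 I hI').1 hc, (h'.2 I hI').1 hc]
    · rw [(h.2 I hI').2 hc, (h'.2 I hI').2 hc]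
  rw [Matroid.indep_iff_eRk_eq_encard_of_finite hfin,
    Matroid.indep_iff_eRk_eq_encard_of_finite hfin, hr]

/-- `M` is the matroid `M(Γ, Γ₁, 𝒜, G, ψ)`: the elementary lift of the frame matroid
`F(G, ψ/Γ₁)` given by the linear class `𝒞(Γ, Γ₁, 𝒜, G, ψ)`. -/
def GainFunction.IsLiftMatroid (ψ : GainFunction G Γ) (Γ₁ : Subgroup Γ) [Γ₁.Normal]
    (𝒜 : Set (Subgroup Γ)) (M : Matroid E) : Prop :=
  ∃ N : Matroid E, (ψ.quot Γ₁).IsFrameMatroid N ∧ IsLiftBy N (ψ.linearClass Γ₁ 𝒜) M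

end Gains

section Groups

variable {Γ : Type w} [Group Γ]

/-- A subgroup `A` is malnormal if `g⁻¹Ag` meets `A` only in the identity for all `g ∉ A`. -/
def IsMalnormal (A : Subgroup Γ) : Prop :=
  ∀ g, g ∉ A → ∀ a ∈ A, g⁻¹ * a * g ∈ A → g⁻¹ * a * g = 1

/-- `{Γ₁} ∪ 𝒜` is a Frobenius partition of `Γ` (for a normal subgroup `Γ₁`). -/
structure IsFrobeniusPartition (Γ₁ : Subgroup Γ) (𝒜 : Set (Subgroup Γ)) : Prop where
  normal : Γ₁.Normal
  partition : ∀ g : Γ, g ≠ 1 → ∃! H : Subgroup Γ, H ∈ {Γ₁} ∪ 𝒜 ∧ g ∈ H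
  malnormal : ∀ A ∈ 𝒜, IsMalnormal A
  conj_mem : ∀ A ∈ 𝒜, ∀ g : Γ, A.map (MulAut.conj g).toMonoidHom ∈ 𝒜

end Groups

section Matroids

/-- Isomorphism of matroids: a bijection of ground sets carrying one matroid to the other. -/
def MatroidIso {α : Type u} {β : Type v} (M : Matroid α) (N : Matroid β) : Prop :=
  ∃ f : M.E ≃ N.E, M.mapSetEquiv f = N

/-- Membership in the class `𝓜(Γ, Γ₁, 𝒜)`: being isomorphic to `M(Γ, Γ₁, 𝒜, G, ψ)` for some
(finite) `Γ`-gain graph `(G, ψ)`. -/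
def InClass {Γ : Type w} [Group Γ] (Γ₁ : Subgroup Γ) [Γ₁.Normal] (𝒜 : Set (Subgroup Γ))
    {α : Type u} (M : Matroid α) : Prop :=
  ∃ (V E : Type) (G : Graph V E) (ψ : GainFunction G Γ) (L : Matroid E),
    V(G).Finite ∧ E(G).Finite ∧ ψ.IsLiftMatroid Γ₁ 𝒜 L ∧ MatroidIso M L

/-- A matroid is simple if it has no loops and no parallel pairs. -/
def IsSimple {α : Type u} (M : Matroid α) : Prop :=
  ∀ e ∈ M.E, ∀ f ∈ M.E, M.Indep {e, f}

/-- An `r`-spike (with a tip `t`): a simple rank-`r` matroid on `2r+1` elements with `r` distinct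
three-element lines `L i` through `t` such that the union of any `k` of these lines has rank
`k + 1`, for `1 ≤ k ≤ r - 1`. -/
def IsSpike {α : Type u} (r : ℕ) (M : Matroid α) : Prop :=
  M.E.encard = 2 * r + 1 ∧ IsSimple M ∧ M.eRank = r ∧
    ∃ (t : α) (L : Fin r → Set α), Function.Injective L ∧
      (∀ i, t ∈ L i ∧ M.IsFlat (L i) ∧ M.eRk (L i) = 2 ∧ (L i).encard = 3) ∧
      ∀ S : Finset (Fin r), S.Nonempty → S.card < r →
        M.eRk (⋃ i ∈ S, L i) = S.card + 1

end Matroids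

end GainMatroid

/-! Existence of spikes: pick `γ ≠ 1` in `Γ₁`, double every edge of an `r`-cycle and add one loop
`t`. Give `t` and one edge of each parallel pair gain `γ`, all others gain `1`. Modulo `Γ₁` every
gain is trivial, so `F(G, ψ/Γ₁)` is the graphic matroid, whose circuits are `t`, the parallel pairs
and the transversals of the pairs. The loop and the pairs are unbalanced for `ψ`, and replacing an
edge by its parallel multiplies the gain of a transversal cycle by `γ^±1`, so no two balanced
transversals differ in one element. This is exactly the condition for the existence of a spike with
tip `t` whose dependent transversals are the balanced ones. Its projection from `t`, with `t` kept
as a loop, is the graphic matroid, and the spike is the elementary lift of that projection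
(`exists_projection`, `eRk_insert_none`).

Failure of direct sums: an elementary lift raises ranks by at most one in total. If a lift `L` of
`N` has additive ranks across two sets, a raised circuit on each side would need a raise of two on
their union, so one side is not raised (`IsLiftBy.good_or_good`). Thus if `M ⊕ M` is in the class,
`M` is isomorphic to a restriction of a frame matroid.

Frame matroids contain no `r`-spike with `r ≥ 5` (`false_of_legs`), by a graph argument that needs
no gains: circuits are connected without pendant edges, and handcuffs and thetas are always
dependent. If the tip is a loop at `u`, every leg spans `u` and one more vertex. If the tip is a
link `uv`, all legs but at most one are triangles on `uv` with some apex. Each leg is spanned by the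
other legs, so each such further vertex or apex lies on another leg. For a loop tip this gives a
loop with a digon. For a link tip no apex lies on three legs, since that gives a theta, so two
different apices are each shared by two legs, and this gives two digons meeting only at `u`. Each
contradicts the independence of transversals. The failure of closure under direct sums follows by
taking `r = 5`. -/

namespace GainMatroid

variable {V : Type u} {E : Type v} {G : Graph V E}

/-! ### Walks, and edge sets that are connected or have no pendant edge. -/

namespace GWalk

theorem start_mem_support : ∀ {x y : V} (p : GWalk G x y), x ∈ p.support
  | _, _, .nil _ => by simp [support]
  | _, _, .cons _ _ _ => by simp [support]

theorem end_mem_support : ∀ {x y : V} (p : GWalk G x y), y ∈ p.support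
  | _, _, .nil _ => by simp [support]
  | _, _, .cons _ _ p => by simp [support, p.end_mem_support]

theorem mem_support_of_inc {e : E} {z : V} : ∀ {x y : V} (p : GWalk G x y), e ∈ p.edges →
    G.Inc e z → z ∈ p.support
  | _, _, .nil _, h, _ => by simp [edges] at h
  | _, _, .cons f hf p, h, hz => by
    simp only [edges, List.mem_cons] at h
    simp only [support, List.mem_cons]
    rcases h with rfl | h
    · rcases hz.eq_or_eq_of_isLink hf with rfl | rfl
      · exact Or.inl rfl
      · exact Or.inr p.start_mem_support
    · exact Or.inr (p.mem_support_of_inc h hz)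

theorem mem_edgeSet_graph {e : E} : ∀ {x y : V} (p : GWalk G x y), e ∈ p.edges → e ∈ E(G)
  | _, _, .nil _, h => by simp [edges] at h
  | _, _, .cons f hf p, h => by
    simp only [edges, List.mem_cons] at h
    rcases h with rfl | h
    · exact hf.edge_mem
    · exact p.mem_edgeSet_graph h

theorem IsPath.edges_nodup : ∀ {x y : V} {p : GWalk G x y}, p.IsPath → p.edges.Nodup
  | _, _, .nil _, _ => by simp [edges]
  | _, _, .cons f hf p, h => by
    simp only [IsPath, support, List.nodup_cons] at h
    simp only [edges, List.nodup_cons]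
    exact ⟨fun hfp => h.1 (p.mem_support_of_inc hfp hf.inc_left), IsPath.edges_nodup (p := p) h.2⟩

/-- An edge that is the only edge of a walk at one of its two ends changes the side of that
end exactly once. -/
theorem mem_edges_iff_of_unique {e : E} {w : V} (he : G.IsNonloopAt e w) :
    ∀ {x y : V} (p : GWalk G x y), p.edges.Nodup → (∀ f ∈ p.edges, G.Inc f w → f = e) →
      (e ∈ p.edges ↔ ¬ (x = w ↔ y = w))
  | _, _, .nil _, _, _ => by simp [edges]
  | x, y, .cons (y := z) f hf p, hnd, huniq => by
    simp only [edges, List.nodup_cons, List.mem_cons, forall_eq_or_imp] at hnd huniq ⊢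
    have ih := mem_edges_iff_of_unique he p hnd.2 huniq.2
    by_cases hfe : f = e
    · subst hfe
      obtain ⟨u, huw, hu⟩ := he
      have : (x = w ∧ z = u) ∨ (x = u ∧ z = w) := hf.eq_and_eq_or_eq_and_eq hu
      have h1 := hnd.1
      rcases this with ⟨rfl, rfl⟩ | ⟨rfl, rfl⟩ <;> grind
    · have hx : x ≠ w := by rintro rfl; exact hfe (huniq.1 hf.inc_left)
      have hz : z ≠ w := by rintro rfl; exact hfe (huniq.1 hf.inc_right)
      grind

theorem exists_inc_start_of_ne {x y : V} (p : GWalk G x y) (h : x ≠ y) :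
    ∃ e ∈ p.edges, G.Inc e x := by
  cases p with
  | nil _ => exact (h rfl).elim
  | cons f hf p => exact ⟨f, by simp [edges], hf.inc_left⟩

theorem exists_inc_end_of_ne : ∀ {x y : V} (p : GWalk G x y), x ≠ y →
    ∃ e ∈ p.edges, G.Inc e y
  | _, _, .nil _, h => (h rfl).elim
  | x, y, .cons (y := z) f hf p, h => by
    by_cases hz : z = y
    · subst hz; exact ⟨f, by simp [edges], hf.inc_right⟩
    · obtain ⟨e, he, hi⟩ := exists_inc_end_of_ne p hz
      exact ⟨e, by simp [edges, he], hi⟩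

theorem iff_of_mem_support {P : V → Prop} : ∀ {x y : V} (p : GWalk G x y),
    (∀ e ∈ p.edges, ∀ a b, G.IsLink e a b → (P a ↔ P b)) → ∀ z ∈ p.support, (P x ↔ P z)
  | _, _, .nil _, _, z, hz => by simp only [support, List.mem_singleton] at hz; rw [hz]
  | _, _, .cons f hf p, h, z, hz => by
    simp only [support, List.mem_cons] at hz
    rcases hz with rfl | hz
    · rfl
    · exact (h f (by simp [edges]) _ _ hf).trans
        (p.iff_of_mem_support (fun e he => h e (by simp [edges, he])) z hz)

end GWalk

/-- No edge of `C` has an end (other than as a loop) that meets no other edge of `C`. -/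
def NoPendant (G : Graph V E) (C : Set E) : Prop :=
  ∀ e ∈ C, ∀ w, G.IsNonloopAt e w → ∃ f ∈ C, f ≠ e ∧ G.Inc f w

/-- The edges of `C` form a connected subgraph. -/
def ConnectedEdges (G : Graph V E) (C : Set E) : Prop :=
  ∀ P : V → Prop, (∀ e ∈ C, ∀ x y, G.IsLink e x y → (P x ↔ P y)) →
    ∀ x ∈ edgeVertices G C, ∀ y ∈ edgeVertices G C, (P x ↔ P y)

/-- A closed walk crosses into and out of a vertex equally often, so it cannot traverse an edge that
is its only edge at a non-loop end. -/
theorem IsCycleSet.noPendant {C : Set E} (h : IsCycleSet G C) : NoPendant G C := by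
  obtain ⟨x, p, hp, rfl⟩ := h
  intro e he w hw
  by_contra! hcon
  have := (p.mem_edges_iff_of_unique hw hp.2.1
    (fun f hf hfw => by_contra fun hne => hcon f hf hne hfw)).1 he
  exact this Iff.rfl

/-- Two edge-disjoint paths with the same two distinct ends form a set without pendant edges. -/
theorem GWalk.IsPath.noPendant_union {x y : V} {p q : GWalk G x y} (hp : p.IsPath)
    (hq : q.IsPath) (hxy : x ≠ y) (hd : Disjoint p.edgeSet q.edgeSet) :
    NoPendant G (p.edgeSet ∪ q.edgeSet) := by
  have key : ∀ p q : GWalk G x y, p.IsPath → Disjoint p.edgeSet q.edgeSet → ∀ e ∈ p.edges, ∀ w,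
      G.IsNonloopAt e w → ∃ f ∈ p.edgeSet ∪ q.edgeSet, f ≠ e ∧ G.Inc f w := by
    intro p q hp hd e he w hw
    by_contra! hcon
    have hw' := (p.mem_edges_iff_of_unique hw hp.edges_nodup
      (fun f hf hfw => by_contra fun hne => hcon f (Or.inl hf) hne hfw)).1 he
    have : ∃ f ∈ q.edges, G.Inc f w := by
      by_cases hx : x = w
      · subst hx; exact q.exists_inc_start_of_ne hxy
      · have hy : y = w := by tauto
        subst hy; exact q.exists_inc_end_of_ne hxy
    obtain ⟨f, hf, hfw⟩ := this
    refine hcon f (Or.inr hf) ?_ hfw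
    rintro rfl
    exact Set.disjoint_left.1 hd he hf
  rintro e (he | he) w hw
  · exact key p q hp hd e he w hw
  · rw [Set.union_comm]
    exact key q p hq hd.symm e he w hw

theorem NoPendant.union {C D : Set E} (hC : NoPendant G C) (hD : NoPendant G D) :
    NoPendant G (C ∪ D) := by
  rintro e (he | he) w hw
  · obtain ⟨f, hf, h⟩ := hC e he w hw
    exact ⟨f, Or.inl hf, h⟩
  · obtain ⟨f, hf, h⟩ := hD e he w hw
    exact ⟨f, Or.inr hf, h⟩

theorem IsTheta.noPendant {C : Set E} (h : IsTheta G C) : NoPendant G C := by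
  obtain ⟨x, y, p, hxy, hp, hd, rfl⟩ := h
  have h01 := (hp 0).noPendant_union (hp 1) hxy (hd 0 1 (by simp)).1
  have h12 := (hp 1).noPendant_union (hp 2) hxy (hd 1 2 (by simp)).1
  convert h01.union h12 using 1
  ext; simp [Fin.exists_fin_succ]; tauto

theorem IsHandcuff.noPendant {C : Set E} (h : IsHandcuff G C) : NoPendant G C := by
  rcases h with ⟨C₁, C₂, h₁, h₂, -, -, rfl⟩ | ⟨C₁, C₂, x, y, p, h₁, h₂, hd, hp, hpx, hpy, rfl⟩
  · exact h₁.noPendant.union h₂.noPendant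
  · intro e he w hw
    by_cases he' : e ∈ C₁ ∪ C₂
    · obtain ⟨f, hf, h⟩ := (h₁.noPendant.union h₂.noPendant) e he' w hw
      exact ⟨f, Or.inl hf, h⟩
    have hep : e ∈ p.edges := he.resolve_left he'
    by_contra! hcon
    have hw' := (p.mem_edges_iff_of_unique hw hp.edges_nodup
      (fun f hf hfw => by_contra fun hne => hcon f (Or.inr hf) hne hfw)).1 hep
    have hx : x ∈ edgeVertices G C₁ := ((Set.ext_iff.1 hpx x).2 rfl).2
    have hy : y ∈ edgeVertices G C₂ := ((Set.ext_iff.1 hpy y).2 rfl).2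
    have : ∃ f ∈ C₁ ∪ C₂, G.Inc f w := by
      by_cases h : x = w
      · subst h; obtain ⟨f, hf, h⟩ := hx; exact ⟨f, Or.inl hf, h⟩
      · have h : y = w := by tauto
        subst h; obtain ⟨f, hf, h⟩ := hy; exact ⟨f, Or.inr hf, h⟩
    obtain ⟨f, hf, hfw⟩ := this
    exact hcon f (Or.inl hf) (by rintro rfl; exact he' hf) hfw

theorem GWalk.connectedEdges {x y : V} (p : GWalk G x y) : ConnectedEdges G p.edgeSet := by
  rintro P hP a ⟨e, he, ha⟩ b ⟨f, hf, hb⟩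
  exact (p.iff_of_mem_support hP a (p.mem_support_of_inc he ha)).symm.trans
    (p.iff_of_mem_support hP b (p.mem_support_of_inc hf hb))

theorem IsCycleSet.connectedEdges {C : Set E} (h : IsCycleSet G C) : ConnectedEdges G C := by
  obtain ⟨x, p, -, rfl⟩ := h
  exact p.connectedEdges

theorem edgeVertices_union (C D : Set E) :
    edgeVertices G (C ∪ D) = edgeVertices G C ∪ edgeVertices G D := by
  ext x; simp only [edgeVertices, Set.mem_union, Set.mem_ofPred_eq]; grind

theorem ConnectedEdges.union {C D : Set E} (hC : ConnectedEdges G C) (hD : ConnectedEdges G D)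
    {z : V} (hzC : z ∈ edgeVertices G C) (hzD : z ∈ edgeVertices G D) :
    ConnectedEdges G (C ∪ D) := by
  intro P hP
  have key : ∀ x ∈ edgeVertices G (C ∪ D), (P x ↔ P z) := by
    intro x hx
    rw [edgeVertices_union] at hx
    rcases hx with hx | hx
    · exact hC P (fun e he => hP e (Or.inl he)) x hx z hzC
    · exact hD P (fun e he => hP e (Or.inr he)) x hx z hzD
  exact fun x hx y hy => (key x hx).trans (key y hy).symm

theorem IsTheta.connectedEdges {C : Set E} (h : IsTheta G C) : ConnectedEdges G C := by
  obtain ⟨x, y, p, hxy, hp, hd, rfl⟩ := h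
  intro P hP
  have key : ∀ a ∈ edgeVertices G (⋃ i, (p i).edgeSet), (P x ↔ P a) := by
    rintro a ⟨e, he, ha⟩
    obtain ⟨i, hi⟩ := Set.mem_iUnion.1 he
    exact (p i).iff_of_mem_support (fun f hf => hP f (Set.mem_iUnion.2 ⟨i, hf⟩)) a
      ((p i).mem_support_of_inc hi ha)
  exact fun x hx y hy => (key x hx).symm.trans (key y hy)

theorem IsHandcuff.connectedEdges {C : Set E} (h : IsHandcuff G C) : ConnectedEdges G C := by
  rcases h with ⟨C₁, C₂, h₁, h₂, -, ⟨x, hx⟩, rfl⟩ | ⟨C₁, C₂, x, y, p, h₁, h₂, hd, hp, hpx, hpy, rfl⟩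
  · have hx' : x ∈ edgeVertices G C₁ ∩ edgeVertices G C₂ := hx ▸ Set.mem_singleton x
    exact h₁.connectedEdges.union h₂.connectedEdges hx'.1 hx'.2
  · have hx : x ∈ edgeVertices G C₁ := ((Set.ext_iff.1 hpx x).2 rfl).2
    have hy : y ∈ edgeVertices G C₂ := ((Set.ext_iff.1 hpy y).2 rfl).2
    have hxy : x ≠ y := by rintro rfl; exact Set.disjoint_left.1 hd hx hy
    have hxp : x ∈ edgeVertices G p.edgeSet := p.exists_inc_start_of_ne hxy
    have hyp : y ∈ edgeVertices G p.edgeSet := p.exists_inc_end_of_ne hxy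
    have h := (h₁.connectedEdges.union p.connectedEdges hx hxp).union h₂.connectedEdges
      (z := y) (by rw [edgeVertices_union]; exact Or.inr hyp) hy
    rwa [Set.union_right_comm] at h

namespace GainFunction

variable {Γ : Type w} [Group Γ] {ψ : GainFunction G Γ} {C : Set E}

theorem IsBalancedCycle.isCycleSet (h : ψ.IsBalancedCycle C) : IsCycleSet G C := by
  obtain ⟨x, p, hp, hC, -⟩ := h
  exact ⟨x, p, hp, hC⟩

theorem IsFrameCircuit.noPendant (h : ψ.IsFrameCircuit C) : NoPendant G C := by
  rcases h with h | ⟨h | h, -⟩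
  exacts [h.isCycleSet.noPendant, h.noPendant, h.noPendant]

theorem IsFrameCircuit.connectedEdges (h : ψ.IsFrameCircuit C) : ConnectedEdges G C := by
  rcases h with h | ⟨h | h, -⟩
  exacts [h.isCycleSet.connectedEdges, h.connectedEdges, h.connectedEdges]

/-- Either some cycle inside is balanced, hence a circuit, or none is and the whole set is a
circuit. Dependence is thus visible in the graph alone, whatever the gains. -/
theorem IsFrameMatroid.dep_of_handcuff_or_theta {N : Matroid E} (hN : ψ.IsFrameMatroid N)
    (h : IsHandcuff G C ∨ IsTheta G C) : ¬ N.Indep C := by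
  intro hi
  by_cases hb : ∃ D ⊆ C, ψ.IsBalancedCycle D
  · obtain ⟨D, hDC, hD⟩ := hb
    exact ((hN.2 D).2 (Or.inl hD)).not_indep (hi.subset hDC)
  · push Not at hb
    exact ((hN.2 C).2 (Or.inr ⟨h, fun D hD _ => hb D hD⟩)).not_indep hi

end GainFunction

end GainMatroid

/-! ### Small handcuffs and thetas, and the shapes of three-edge circuits. -/

namespace GainMatroid

variable {V : Type u} {E : Type v} {G : Graph V E}

theorem edgeVertices_singleton {e : E} {x y : V} (h : G.IsLink e x y) :
    edgeVertices G {e} = {x, y} := by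
  ext z
  simp only [edgeVertices, Set.mem_singleton_iff, exists_eq_left, Set.mem_ofPred_eq,
    Set.mem_insert_iff]
  constructor
  · exact fun hz => hz.eq_or_eq_of_isLink h
  · rintro (rfl | rfl)
    exacts [h.inc_left, h.inc_right]

theorem edgeVertices_pair {e f : E} {x y : V} (he : G.IsLink e x y) (hf : G.IsLink f x y) :
    edgeVertices G {e, f} = {x, y} := by
  rw [Set.insert_eq, edgeVertices_union, edgeVertices_singleton he, edgeVertices_singleton hf,
    Set.union_self]

theorem isCycleSet_loop {e : E} {x : V} (h : G.IsLink e x x) : IsCycleSet G {e} :=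
  ⟨x, .cons e h (.nil h.left_mem), by simp [GWalk.IsSimpleClosed, GWalk.edges, GWalk.support],
    by ext; simp [GWalk.edgeSet, GWalk.edges]⟩

theorem isCycleSet_digon {e f : E} {x y : V} (he : G.IsLink e x y) (hf : G.IsLink f x y)
    (hef : e ≠ f) (hxy : x ≠ y) : IsCycleSet G {e, f} :=
  ⟨x, .cons e he (.cons f hf.symm (.nil hf.left_mem)),
    by simp [GWalk.IsSimpleClosed, GWalk.edges, GWalk.support, hef, hxy.symm],
    by ext; simp [GWalk.edgeSet, GWalk.edges]⟩

theorem isTightHandcuff_loops {e f : E} {x : V} (he : G.IsLink e x x) (hf : G.IsLink f x x)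
    (hef : e ≠ f) : IsTightHandcuff G {e, f} :=
  ⟨{e}, {f}, isCycleSet_loop he, isCycleSet_loop hf, by simpa using hef, ⟨x, by
    rw [edgeVertices_singleton he, edgeVertices_singleton hf]; simp⟩, rfl⟩

theorem isTightHandcuff_loop_digon {l e f : E} {x y : V} (hl : G.IsLink l x x)
    (he : G.IsLink e x y) (hf : G.IsLink f x y) (hef : e ≠ f) (hxy : x ≠ y) :
    IsTightHandcuff G {l, e, f} := by
  refine ⟨{l}, {e, f}, isCycleSet_loop hl, isCycleSet_digon he hf hef hxy, ?_, ⟨x, ?_⟩, rfl⟩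
  · rw [Set.disjoint_singleton_left]
    rintro (rfl | rfl)
    exacts [hxy (he.right_unique hl).symm, hxy (hf.right_unique hl).symm]
  · rw [edgeVertices_singleton hl, edgeVertices_pair he hf]; ext; simp

theorem isTightHandcuff_digons {e f g h : E} {x y z : V} (he : G.IsLink e x y)
    (hf : G.IsLink f x y) (hg : G.IsLink g x z) (hh : G.IsLink h x z) (hef : e ≠ f) (hgh : g ≠ h)
    (hxy : x ≠ y) (hxz : x ≠ z) (hyz : y ≠ z) : IsTightHandcuff G {e, f, g, h} := by
  refine ⟨{e, f}, {g, h}, isCycleSet_digon he hf hef hxy, isCycleSet_digon hg hh hgh hxz, ?_,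
    ⟨x, ?_⟩, by ext; simp; tauto⟩
  · rw [Set.disjoint_left]
    rintro a (rfl | rfl) (rfl | rfl)
    exacts [hyz (he.right_unique hg), hyz (he.right_unique hh), hyz (hf.right_unique hg),
      hyz (hf.right_unique hh)]
  · rw [edgeVertices_pair hg hh, edgeVertices_pair he hf]; ext; simp; grind

theorem isLooseHandcuff_loops_link {l l' e : E} {x y : V} (hl : G.IsLink l x x)
    (hl' : G.IsLink l' y y) (he : G.IsLink e x y) (hxy : x ≠ y) :
    IsLooseHandcuff G {e, l, l'} := by
  refine ⟨{l}, {l'}, x, y, .cons e he (.nil he.right_mem), isCycleSet_loop hl, isCycleSet_loop hl',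
    ?_, ?_, ?_, ?_, ?_⟩
  · rw [edgeVertices_singleton hl, edgeVertices_singleton hl']; simpa using hxy
  · simpa [GWalk.IsPath, GWalk.support] using hxy
  · rw [edgeVertices_singleton hl]; ext; simp [GWalk.vertexSet, GWalk.support]
  · rw [edgeVertices_singleton hl']; ext; simp [GWalk.vertexSet, GWalk.support]
  · ext; simp [GWalk.edgeSet, GWalk.edges]; tauto

theorem isTheta_links {e : Fin 3 → E} {x y : V} (he : ∀ i, G.IsLink (e i) x y)
    (hinj : Function.Injective e) (hxy : x ≠ y) : IsTheta G (Set.range e) := by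
  refine ⟨x, y, fun i => .cons (e i) (he i) (.nil (he i).right_mem), hxy, ?_, ?_, ?_⟩
  · intro i; simpa [GWalk.IsPath, GWalk.support] using hxy
  · intro i j hij
    constructor
    · simpa [GWalk.edgeSet, GWalk.edges] using fun h => hij (hinj h)
    · ext; simp [GWalk.vertexSet, GWalk.support]
  · ext; simp [GWalk.edgeSet, GWalk.edges, eq_comm]

theorem isTheta_triple {e f g : E} {x y : V} (he : G.IsLink e x y) (hf : G.IsLink f x y)
    (hg : G.IsLink g x y) (hef : e ≠ f) (heg : e ≠ g) (hfg : f ≠ g) (hxy : x ≠ y) :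
    IsTheta G {e, f, g} := by
  have h := isTheta_links (e := ![e, f, g]) (x := x) (y := y) (by
    intro i; fin_cases i <;> assumption) (by
    intro i j hij; fin_cases i <;> fin_cases j <;> simp_all) hxy
  convert h using 1
  ext; simp; tauto

/-- A three-edge connected set without pendant edges that contains a loop at `x` and no other
loop at `x`: its remaining edges span two vertices. -/
theorem exists_link_of_loop {t a b : E} {x : V} (hp : NoPendant G {t, a, b})
    (hc : ConnectedEdges G {t, a, b}) (ht : G.IsLink t x x) (ha : a ∈ E(G)) (hb : b ∈ E(G))
    (hax : ¬ G.IsLink a x x) (hbx : ¬ G.IsLink b x x) :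
    ∃ y, y ≠ x ∧ (G.IsLink a x y ∨ G.IsLink b x y) ∧
      ∀ f ∈ ({t, a, b} : Set E), ∀ z, G.Inc f z → z = x ∨ z = y := by
  have hinc : G.Inc a x ∨ G.Inc b x := by
    by_contra! hcon
    obtain ⟨y, z, hyz⟩ := G.exists_isLink_of_mem_edgeSet ha
    -- If neither `a` nor `b` met `x`, being equal to `x` would be constant along every edge,
    -- against connectedness.
    have h := hc (· = x) (by
      rintro e (rfl | rfl | rfl) p q hpq
      · have := hpq.eq_and_eq_or_eq_and_eq ht; grind
      · have h1 : p ≠ x := by rintro rfl; exact hcon.1 hpq.inc_left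
        have h2 : q ≠ x := by rintro rfl; exact hcon.1 hpq.inc_right
        simp [h1, h2]
      · have h1 : p ≠ x := by rintro rfl; exact hcon.2 hpq.inc_left
        have h2 : q ≠ x := by rintro rfl; exact hcon.2 hpq.inc_right
        simp [h1, h2]) x ⟨t, by simp, ht.inc_left⟩ y ⟨a, by simp, hyz.inc_left⟩
    have : y = x := h.1 rfl
    exact hcon.1 (this ▸ hyz.inc_left)
  have key : ∀ a b : E, NoPendant G {t, a, b} → b ∈ E(G) → ¬ G.IsLink a x x → G.Inc a x →
      ∃ y, y ≠ x ∧ G.IsLink a x y ∧ ∀ z, G.Inc b z → z = x ∨ z = y := by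
    intro a b hp hb hax ⟨y, hy⟩
    have hyx : y ≠ x := by rintro rfl; exact hax hy
    refine ⟨y, hyx, hy, ?_⟩
    have hby : G.Inc b y := by
      obtain ⟨f, hf, hfa, hfy⟩ := hp a (by simp) y ⟨x, hyx.symm, hy.symm⟩
      rcases hf with rfl | rfl | rfl
      · exact absurd (hfy.eq_or_eq_of_isLink ht) (by simp [hyx])
      · exact absurd rfl hfa
      · exact hfy
    obtain ⟨d, hd⟩ := hby
    intro z hz
    rcases hz.eq_or_eq_of_isLink hd with rfl | rfl
    · exact Or.inr rfl
    by_contra! hcon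
    obtain ⟨f, hf, hfb, hfz⟩ := hp b (by simp) z ⟨y, hcon.2.symm, hd.symm⟩
    rcases hf with rfl | rfl | rfl
    · exact hcon.1 (by simpa using hfz.eq_or_eq_of_isLink ht)
    · exact absurd (hfz.eq_or_eq_of_isLink hy) (by simp [hcon])
    · exact hfb rfl
  rcases hinc with h | h
  · obtain ⟨y, hyx, hy, hz⟩ := key a b hp hb hax h
    refine ⟨y, hyx, Or.inl hy, ?_⟩
    rintro f (rfl | rfl | rfl) z hfz
    · exact Or.inl (by simpa using hfz.eq_or_eq_of_isLink ht)
    · exact hfz.eq_or_eq_of_isLink hy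
    · exact hz z hfz
  · obtain ⟨y, hyx, hy, hz⟩ := key b a (by rwa [Set.pair_comm]) ha hbx h
    refine ⟨y, hyx, Or.inr hy, ?_⟩
    rintro f (rfl | rfl | rfl) z hfz
    · exact Or.inl (by simpa using hfz.eq_or_eq_of_isLink ht)
    · exact hz z hfz
    · exact hfz.eq_or_eq_of_isLink hy

/-- A three-edge connected set without pendant edges that contains a link `t` either spans only
the ends of `t` or is a triangle. -/
theorem span_or_triangle_of_link {t a b : E} {x y : V} (hp : NoPendant G {t, a, b})
    (hc : ConnectedEdges G {t, a, b}) (ht : G.IsLink t x y) (hxy : x ≠ y) :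
    (∀ f ∈ ({t, a, b} : Set E), ∀ z, G.Inc f z → z = x ∨ z = y) ∨
      ∃ z, z ≠ x ∧ z ≠ y ∧
        ((G.IsLink a x z ∧ G.IsLink b y z) ∨ (G.IsLink b x z ∧ G.IsLink a y z)) := by
  have key : ∀ a b : E, NoPendant G {t, a, b} → ConnectedEdges G {t, a, b} →
      ∀ z, G.Inc a z → z ≠ x → z ≠ y →
        (G.IsLink a x z ∧ G.IsLink b y z) ∨ (G.IsLink b x z ∧ G.IsLink a y z) := by
    rintro a b hp hc z ⟨c, hac⟩ hzx hzy
    have hx : G.Inc a x ∨ G.Inc b x := by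
      obtain ⟨f, hf, hft, hfx⟩ := hp t (by simp) x ⟨y, hxy.symm, ht⟩
      rcases hf with rfl | rfl | rfl
      exacts [absurd rfl hft, Or.inl hfx, Or.inr hfx]
    have hy : G.Inc a y ∨ G.Inc b y := by
      obtain ⟨f, hf, hft, hfx⟩ := hp t (by simp) y ⟨x, hxy, ht.symm⟩
      rcases hf with rfl | rfl | rfl
      exacts [absurd rfl hft, Or.inl hfx, Or.inr hfx]
    by_cases hcz : c = z
    · subst hcz
      have hnx : ¬ G.Inc a x := fun h => hzx (by simpa [eq_comm] using h.eq_or_eq_of_isLink hac)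
      have hny : ¬ G.Inc a y := fun h => hzy (by simpa [eq_comm] using h.eq_or_eq_of_isLink hac)
      have hbx := hx.resolve_left hnx
      have hby := hy.resolve_left hny
      have hbxy : G.IsLink b x y := by
        obtain ⟨d, hd⟩ := hbx
        rcases hby.eq_or_eq_of_isLink hd with rfl | rfl
        exacts [absurd rfl hxy, hd]
      have h := hc (· = c) (by
        rintro e (rfl | rfl | rfl) p q hpq
        · have := hpq.eq_and_eq_or_eq_and_eq ht; grind
        · have := hpq.eq_and_eq_or_eq_and_eq hac; grind
        · have := hpq.eq_and_eq_or_eq_and_eq hbxy; grind) c ⟨a, by simp, hac.inc_left⟩ x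
          ⟨t, by simp, ht.inc_left⟩
      exact absurd (h.1 rfl).symm hzx
    · obtain ⟨d, hbd⟩ : G.Inc b z := by
        obtain ⟨f, hf, hfa, hfz⟩ := hp a (by simp) z ⟨c, hcz, hac⟩
        rcases hf with rfl | rfl | rfl
        · exact absurd (hfz.eq_or_eq_of_isLink ht) (by simp [hzx, hzy])
        · exact absurd rfl hfa
        · exact hfz
      have hx' : x = c ∨ x = d := by
        rcases hx with h | h
        · exact Or.inl ((h.eq_or_eq_of_isLink hac).resolve_left hzx.symm)
        · exact Or.inr ((h.eq_or_eq_of_isLink hbd).resolve_left hzx.symm)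
      have hy' : y = c ∨ y = d := by
        rcases hy with h | h
        · exact Or.inl ((h.eq_or_eq_of_isLink hac).resolve_left hzy.symm)
        · exact Or.inr ((h.eq_or_eq_of_isLink hbd).resolve_left hzy.symm)
      rcases hx' with rfl | rfl <;> rcases hy' with rfl | rfl
      · exact absurd rfl hxy
      · exact Or.inl ⟨hac.symm, hbd.symm⟩
      · exact Or.inr ⟨hbd.symm, hac.symm⟩
      · exact absurd rfl hxy
  by_contra! hcon
  obtain ⟨⟨f, hf, z, hfz, hzx, hzy⟩, hcon⟩ := hcon
  rcases hf with rfl | rfl | rfl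
  · exact absurd (hfz.eq_or_eq_of_isLink ht) (by simp [hzx, hzy])
  · rcases key f b hp hc z hfz hzx hzy with h | h
    exacts [(hcon z hzx hzy).1 h.1 h.2, (hcon z hzx hzy).2 h.1 h.2]
  · rcases key f a (by rwa [Set.pair_comm]) (by rwa [Set.pair_comm]) z hfz hzx hzy with h | h
    exacts [(hcon z hzx hzy).2 h.1 h.2, (hcon z hzx hzy).1 h.1 h.2]

end GainMatroid

/-! ### The graph argument excluding large spikes from frame matroids. -/

namespace GainMatroid

variable {V : Type u} {E : Type v} {G : Graph V E} {Γ : Type w} [Group Γ]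
  {ψ : GainFunction G Γ} {N : Matroid E}

namespace GainFunction

/-- The element `e` lies in a circuit whose other elements are in `X`, and circuits have no pendant
edges. -/
theorem IsFrameMatroid.exists_inc_of_mem_closure (hN : ψ.IsFrameMatroid N) {e : E} {X : Set E}
    {w : V} (hw : G.IsNonloopAt e w) (heX : e ∉ X) (he : e ∈ N.closure X) :
    ∃ f ∈ X, G.Inc f w := by
  obtain ⟨C, hCX, hC, heC⟩ := (Matroid.mem_closure_iff_exists_isCircuit heX).1 he
  obtain ⟨f, hf, hfe, hfw⟩ := ((hN.2 C).1 hC).noPendant e heC w hw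
  exact ⟨f, (hCX hf).resolve_left hfe, hfw⟩

/-- A frame matroid has no spike of rank at least five, with its legs given as triangles `L i`
through the tip `t`. -/
theorem IsFrameMatroid.false_of_legs (hN : ψ.IsFrameMatroid N) {r : ℕ} (hr : 5 ≤ r) {t : E}
    {L : Fin r → Set E} (hL : ∀ i, ∃ a b, L i = {t, a, b} ∧ t ≠ a ∧ t ≠ b ∧ a ≠ b)
    (hcirc : ∀ i, N.IsCircuit (L i)) (hdisj : ∀ i j, i ≠ j → ∀ a ∈ L i, a ∈ L j → a = t)
    (h2 : ∀ i j, i ≠ j → ∀ a ∈ L i, ∀ b ∈ L j, a ≠ t → b ≠ t → N.Indep {t, a, b})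
    (h3 : ∀ i j k, i ≠ j → i ≠ k → j ≠ k → ∀ a ∈ L i, ∀ b ∈ L j, ∀ c ∈ L k,
      a ≠ t → b ≠ t → c ≠ t → N.Indep {a, b, c})
    (h4 : ∀ i j k l, i ≠ j → i ≠ k → i ≠ l → j ≠ k → j ≠ l → k ≠ l →
      ∀ a ∈ L i, ∀ b ∈ L j, ∀ c ∈ L k, ∀ d ∈ L l,
      a ≠ t → b ≠ t → c ≠ t → d ≠ t → N.Indep {a, b, c, d})
    (hcl : ∀ i, L i ⊆ N.closure (⋃ j ≠ i, L j)) : False := by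
  have hne : ∀ i j, i ≠ j → ∀ a ∈ L i, ∀ b ∈ L j, a ≠ t → a ≠ b := by
    rintro i j hij a ha b hb hat rfl
    exact hat (hdisj i j hij a ha hb)
  have hground : ∀ i, ∀ a ∈ L i, a ∈ E(G) := fun i a ha => hN.1 ▸ (hcirc i).subset_ground ha
  -- The other legs span `L i`, so their union must reach each non-loop end of `e`. The edge found
  -- may be the tip.
  have hshare : ∀ i, ∀ e ∈ L i, e ≠ t → ∀ w, G.IsNonloopAt e w →
      ∃ j, i ≠ j ∧ ∃ f ∈ L j, G.Inc f w := by
    intro i e he het w hw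
    have heX : e ∉ ⋃ j ≠ i, L j := by
      simp only [Set.mem_iUnion, not_exists]
      exact fun j hj hej => het (hdisj i j hj.symm e he hej)
    obtain ⟨f, hf, hfw⟩ := hN.exists_inc_of_mem_closure hw heX (hcl i he)
    simp only [Set.mem_iUnion] at hf
    obtain ⟨j, hj, hf⟩ := hf
    exact ⟨j, hj.symm, f, hf, hfw⟩
  have hnp : ∀ i, NoPendant G (L i) := fun i => ((hN.2 _).1 (hcirc i)).noPendant
  have hcon : ∀ i, ConnectedEdges G (L i) := fun i => ((hN.2 _).1 (hcirc i)).connectedEdges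
  have htE : t ∈ E(G) := by
    obtain ⟨a, b, h, -⟩ := hL ⟨0, by omega⟩
    exact hground ⟨0, by omega⟩ t (by rw [h]; simp)
  obtain ⟨u, v, huv⟩ := G.exists_isLink_of_mem_edgeSet htE
  -- If the tip is a loop, each leg spans `u` and one vertex `w i`. By `hshare` some `w i` lies on
  -- another leg, and the tip with one link from each of the two legs is a tight handcuff.
  by_cases huv' : u = v
  · subst huv'
    have hleg : ∀ i, ∃ y, y ≠ u ∧ (∃ e ∈ L i, e ≠ t ∧ G.IsLink e u y) ∧
        ∀ f ∈ L i, ∀ z, G.Inc f z → z = u ∨ z = y := by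
      intro i
      obtain ⟨a, b, hi, hta, htb, hab⟩ := hL i
      -- Two loops at `u` form a handcuff, which would be a dependent proper subset of the circuit
      -- `L i`.
      have hloop : ∀ a b, L i = {t, a, b} → t ≠ a → t ≠ b → a ≠ b → ¬ G.IsLink a u u := by
        intro a b hi hta htb hab hau
        refine hN.dep_of_handcuff_or_theta (Or.inl (Or.inl (isTightHandcuff_loops huv hau hta)))
          ((hcirc i).ssubset_indep ?_)
        rw [hi]
        refine ⟨by intro; simp; tauto, fun h => ?_⟩
        have := h (show b ∈ _ by simp)
        simp only [Set.mem_insert_iff, Set.mem_singleton_iff] at this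
        tauto
      have hp := hnp i
      have hc := hcon i
      rw [hi] at hp hc
      obtain ⟨y, hyu, hy, hz⟩ := exists_link_of_loop hp hc huv (hground i a (by simp [hi]))
        (hground i b (by simp [hi])) (hloop a b hi hta htb hab)
        (hloop b a (by rw [hi, Set.pair_comm]) htb hta hab.symm)
      refine ⟨y, hyu, ?_, hi ▸ hz⟩
      rcases hy with hy | hy
      · exact ⟨a, by simp [hi], hta.symm, hy⟩
      · exact ⟨b, by simp [hi], htb.symm, hy⟩
    choose w hwu hlink hspan using hleg
    choose e heL het he using hlink
    obtain ⟨j, hij, f, hf, hfw⟩ := hshare ⟨0, by omega⟩ _ (heL ⟨0, by omega⟩) (het _) _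
      ⟨u, (hwu _).symm, (he ⟨0, by omega⟩).symm⟩
    have hww := (hspan j f hf _ hfw).resolve_left
      (hwu _)
    have hej := he j
    rw [← hww] at hej
    exact hN.dep_of_handcuff_or_theta (Or.inl (Or.inl (isTightHandcuff_loop_digon huv
      (he ⟨0, by omega⟩) hej (hne _ _ hij _ (heL _) _ (heL j) (het _)) (hwu _).symm)))
      (h2 _ _ hij _ (heL _) _ (heL j) (het _) (het j))
  -- The tip is now a link: a leg either lies on `u, v` or is a triangle with apex `w i`. For legs
  -- on `u, v` the value of `w` is a dummy.
  let Sp : Fin r → Prop := fun i => ∀ f ∈ L i, ∀ z, G.Inc f z → z = u ∨ z = v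
  have htri : ∀ i, ∃ z, ¬ Sp i → z ≠ u ∧ z ≠ v ∧ (∃ e ∈ L i, e ≠ t ∧ G.IsLink e u z) ∧
      ∀ f ∈ L i, ∀ y, G.Inc f y → y = u ∨ y = v ∨ y = z := by
    intro i
    by_cases hSp : Sp i
    · exact ⟨u, fun h => absurd hSp h⟩
    obtain ⟨a, b, hi, hta, htb, hab⟩ := hL i
    have hp := hnp i
    have hc := hcon i
    rw [hi] at hp hc
    obtain ⟨z, hzu, hzv, h⟩ := (span_or_triangle_of_link hp hc huv huv').resolve_left (hi ▸ hSp)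
    refine ⟨z, fun _ => ⟨hzu, hzv, ?_, ?_⟩⟩
    · rcases h with h | h
      · exact ⟨a, by simp [hi], hta.symm, h.1⟩
      · exact ⟨b, by simp [hi], htb.symm, h.1⟩
    · rw [hi]
      rintro f (rfl | rfl | rfl) y hy
      · have := hy.eq_or_eq_of_isLink huv; tauto
      · rcases h with h | h
        · have := hy.eq_or_eq_of_isLink h.1; tauto
        · have := hy.eq_or_eq_of_isLink h.2; tauto
      · rcases h with h | h
        · have := hy.eq_or_eq_of_isLink h.2; tauto
        · have := hy.eq_or_eq_of_isLink h.1; tauto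
  choose w hw using htri
  -- at most one leg is spanned by the ends of the tip
  have hSp1 : ∀ i j, i ≠ j → Sp i → Sp j → False := by
    have hkind : ∀ i, Sp i → ∃ a ∈ L i, a ≠ t ∧
        (G.IsLink a u v ∨ G.IsLink a u u ∨ G.IsLink a v v) := by
      intro i hi
      obtain ⟨a, b, hLi, hta, htb, hab⟩ := hL i
      have ha : a ∈ L i := by simp [hLi]
      refine ⟨a, ha, hta.symm, ?_⟩
      obtain ⟨p, q, hpq⟩ := G.exists_isLink_of_mem_edgeSet (hground i a ha)
      rcases hi a ha p hpq.inc_left with rfl | rfl <;> rcases hi a ha q hpq.inc_right with rfl | rfl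
      exacts [Or.inr (Or.inl hpq), Or.inl hpq, Or.inl hpq.symm, Or.inr (Or.inr hpq)]
    intro i j hij hi hj
    obtain ⟨a, ha, hat, hak⟩ := hkind i hi
    obtain ⟨b, hb, hbt, hbk⟩ := hkind j hj
    have hab := hne i j hij a ha b hb hat
    have hI := h2 i j hij a ha b hb hat hbt
    have hI1 : N.Indep {a, b} := hI.subset (by simp)
    have hI2 : N.Indep {b, t, a} := hI.subset (by intro; simp; tauto)
    have hI3 : N.Indep {a, t, b} := hI.subset (by intro; simp; tauto)
    have hI4 : N.Indep {t, b, a} := hI.subset (by intro; simp; tauto)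
    have hd : ∀ {C}, IsHandcuff G C ∨ IsTheta G C → N.Indep C → False :=
      fun h => hN.dep_of_handcuff_or_theta h
    -- With the tip, two links give a theta, a loop and a link give a loop with a digon, and loops
    -- at different ends give a loose handcuff. Two loops at the same end already form a tight
    -- handcuff.
    rcases hak with hak | hak | hak <;> rcases hbk with hbk | hbk | hbk
    · exact hd (Or.inr (isTheta_triple huv hak hbk hat.symm hbt.symm hab huv')) hI
    · exact hd (Or.inl (Or.inl (isTightHandcuff_loop_digon hbk huv hak hat.symm huv'))) hI2
    · exact hd (Or.inl (Or.inl (isTightHandcuff_loop_digon hbk huv.symm hak.symm hat.symm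
        (Ne.symm huv')))) hI2
    · exact hd (Or.inl (Or.inl (isTightHandcuff_loop_digon hak huv hbk hbt.symm huv'))) hI3
    · exact hd (Or.inl (Or.inl (isTightHandcuff_loops hak hbk hab))) hI1
    · exact hd (Or.inl (Or.inr (isLooseHandcuff_loops_link hak hbk huv huv'))) hI
    · exact hd (Or.inl (Or.inl (isTightHandcuff_loop_digon hak huv.symm hbk.symm hbt.symm
        (Ne.symm huv')))) hI3
    · exact hd (Or.inl (Or.inr (isLooseHandcuff_loops_link hbk hak huv huv'))) hI4
    · exact hd (Or.inl (Or.inl (isTightHandcuff_loops hak hbk hab))) hI1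
  -- The edge supplied by `hshare` at the apex avoids `u, v` there, so its leg is a triangle with
  -- the same apex.
  have hpartner : ∀ i, ¬ Sp i → ∃ j, i ≠ j ∧ ¬ Sp j ∧ w i = w j := by
    intro i hi
    obtain ⟨hwu, hwv, ⟨e, heL, het, he⟩, -⟩ := hw i hi
    obtain ⟨j, hij, f, hf, hfw⟩ := hshare i e heL het (w i) ⟨u, hwu.symm, he.symm⟩
    have hj : ¬ Sp j := fun hj => (hj f hf _ hfw).elim hwu hwv
    refine ⟨j, hij, hj, ?_⟩
    have := (hw j hj).2.2.2 f hf _ hfw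
    tauto
  have hthree : ∀ i j k, i ≠ j → i ≠ k → j ≠ k → ¬ Sp i → ¬ Sp j → ¬ Sp k →
      w i = w j → w i = w k → False := by
    intro i j k hij hik hjk hi hj hk hwij hwik
    obtain ⟨hwu, -, ⟨a, haL, hat, ha⟩, -⟩ := hw i hi
    obtain ⟨-, -, ⟨b, hbL, hbt, hb⟩, -⟩ := hw j hj
    obtain ⟨-, -, ⟨c, hcL, hct, hc⟩, -⟩ := hw k hk
    rw [← hwij] at hb
    rw [← hwik] at hc
    exact hN.dep_of_handcuff_or_theta (Or.inr (isTheta_triple ha hb hc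
      (hne i j hij a haL b hbL hat) (hne i k hik a haL c hcL hat) (hne j k hjk b hbL c hcL hbt)
      hwu.symm)) (h3 i j k hij hik hjk a haL b hbL c hcL hat hbt hct)
  obtain ⟨i, hi⟩ : ∃ i, ¬ Sp i := by
    by_contra! h
    exact hSp1 ⟨0, by omega⟩ ⟨1, by omega⟩ (by simp) (h _) (h _)
  obtain ⟨j, hij, hj, hwij⟩ := hpartner i hi
  -- Two legs besides `i, j` are enough, since at most one leg satisfies `Sp`. The fourth leg will
  -- come from `hpartner`.
  obtain ⟨k, hki, hkj, hk⟩ : ∃ k, k ≠ i ∧ k ≠ j ∧ ¬ Sp k := by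
    have hcard : 1 < (({i, j} : Finset (Fin r))ᶜ).card := by
      have := Finset.card_le_two (a := i) (b := j)
      rw [Finset.card_compl, Fintype.card_fin]
      omega
    obtain ⟨k, hk, k', hk', hkk⟩ := Finset.one_lt_card.1 hcard
    simp only [Finset.mem_compl, Finset.mem_insert, Finset.mem_singleton, not_or] at hk hk'
    by_cases h : Sp k
    · exact ⟨k', hk'.1, hk'.2, fun h' => hSp1 k k' hkk h h'⟩
    · exact ⟨k, hk.1, hk.2, h⟩
  have hwik : w i ≠ w k := fun h => hthree i j k hij hki.symm hkj.symm hi hj hk hwij h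
  obtain ⟨l, hkl, hl, hwkl⟩ := hpartner k hk
  have hli : i ≠ l := by rintro rfl; exact hwik hwkl.symm
  have hlj : j ≠ l := by rintro rfl; exact hwik (hwij.trans hwkl.symm)
  obtain ⟨hwiu, -, ⟨a, haL, hat, ha⟩, -⟩ := hw i hi
  obtain ⟨-, -, ⟨b, hbL, hbt, hb⟩, -⟩ := hw j hj
  obtain ⟨hwku, -, ⟨c, hcL, hct, hc⟩, -⟩ := hw k hk
  obtain ⟨-, -, ⟨d, hdL, hdt, hd⟩, -⟩ := hw l hl
  rw [← hwij] at hb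
  rw [← hwkl] at hd
  exact hN.dep_of_handcuff_or_theta (Or.inl (Or.inl (isTightHandcuff_digons ha hb hc hd
    (hne i j hij a haL b hbL hat) (hne k l hkl c hcL d hdL hct) hwiu.symm hwku.symm hwik)))
    (h4 i j k l hij hki.symm hli hkj.symm hlj hkl a haL b hbL c hcL d hdL hat hbt hct hdt)

end GainFunction

end GainMatroid

/-! ### Rank properties of the legs of a spike. -/

namespace GainMatroid

section Legs

variable {E : Type v} {N : Matroid E}

/-- The legs `L i` of a rank-`r` spike with tip `t`, as a family of subsets of a matroid. -/
structure IsLegFamily (N : Matroid E) (r : ℕ) (t : E) (L : Fin r → Set E) : Prop where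
  tip_mem : ∀ i, t ∈ L i
  encard_eq : ∀ i, (L i).encard = 3
  eRk_eq : ∀ i, N.eRk (L i) = 2
  indep_pair : ∀ a ∈ ⋃ i, L i, ∀ b ∈ ⋃ i, L i, N.Indep {a, b}
  eRk_biUnion : ∀ S : Finset (Fin r), S.Nonempty → S.card < r →
    N.eRk (⋃ i ∈ S, L i) = S.card + 1
  eRk_iUnion_le : N.eRk (⋃ i, L i) ≤ r

namespace IsLegFamily

variable {r : ℕ} {t : E} {L : Fin r → Set E}

theorem indep_pair' (h : IsLegFamily N r t L) {i j : Fin r} {a b : E} (ha : a ∈ L i)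
    (hb : b ∈ L j) : N.Indep {a, b} :=
  h.indep_pair a (Set.mem_iUnion.2 ⟨i, ha⟩) b (Set.mem_iUnion.2 ⟨j, hb⟩)

theorem subset_ground (h : IsLegFamily N r t L) (i : Fin r) : L i ⊆ N.E := fun a ha =>
  (h.indep_pair' ha ha).subset_ground (by simp)

theorem exists_eq (h : IsLegFamily N r t L) (i : Fin r) :
    ∃ a b, L i = {t, a, b} ∧ t ≠ a ∧ t ≠ b ∧ a ≠ b := by
  obtain ⟨x, y, z, hxy, hxz, hyz, hL⟩ := Set.encard_eq_three.1 (h.encard_eq i)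
  have ht := h.tip_mem i
  rw [hL] at ht ⊢
  rcases ht with rfl | rfl | rfl
  · exact ⟨y, z, rfl, hxy, hxz, hyz⟩
  · exact ⟨x, z, Set.insert_comm _ _ _, hxy.symm, hyz, hxz⟩
  · exact ⟨x, y, by ext; simp; tauto, hxz.symm, hyz.symm, hxy⟩

theorem isCircuit (h : IsLegFamily N r t L) (i : Fin r) : N.IsCircuit (L i) := by
  have hfin : (L i).Finite := Set.finite_of_encard_eq_coe (k := 3) (h.encard_eq i)
  rw [Matroid.isCircuit_iff_dep_forall_sdiff_singleton_indep]
  constructor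
  · rw [← Matroid.eRk_lt_encard_iff_dep_of_finite hfin (h.subset_ground i), h.eRk_eq, h.encard_eq]
    norm_num
  · intro e he
    have hcard : (L i \ {e}).encard = 2 := by
      have := Set.encard_sdiff_singleton_add_one he
      rw [h.encard_eq] at this
      have h3 : (3 : ℕ∞) = 2 + 1 := by norm_num
      rw [h3] at this
      exact WithTop.add_right_cancel ENat.one_ne_top this
    obtain ⟨x, y, -, hxy⟩ := Set.encard_eq_two.1 hcard
    rw [hxy]
    exact h.indep_pair' (i := i) (j := i) (hxy.symm.subset (by simp)).1
      (hxy.symm.subset (by simp)).1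

/-- By submodularity, two legs of rank 2 whose union has rank 3 meet in rank at most 1, while a
second common element would form an independent pair with the tip. -/
theorem eq_tip (h : IsLegFamily N r t L) (hr : 3 ≤ r) {i j : Fin r} (hij : i ≠ j) {a : E}
    (hai : a ∈ L i) (haj : a ∈ L j) : a = t := by
  by_contra hat
  have h1 := N.eRk_inter_add_eRk_union_le (L i) (L j)
  have h2 := h.eRk_biUnion {i, j} (by simp) (by rw [Finset.card_pair hij]; omega)
  rw [Finset.card_pair hij] at h2
  simp only [Finset.mem_insert, Finset.mem_singleton, Set.iUnion_iUnion_eq_or_left,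
    Set.iUnion_iUnion_eq_left] at h2
  have h3 : N.eRk {a, t} ≤ N.eRk (L i ∩ L j) := N.eRk_mono (by
    rintro x (rfl | rfl)
    exacts [⟨hai, haj⟩, ⟨h.tip_mem i, h.tip_mem j⟩])
  rw [(h.indep_pair' hai (h.tip_mem i)).eRk_eq_encard, Set.encard_pair hat] at h3
  rw [h2, h.eRk_eq, h.eRk_eq] at h1
  have := (add_le_add_left h3 _).trans h1
  norm_num at this

theorem subset_closure (h : IsLegFamily N r t L) {i : Fin r} {a : E} (ha : a ∈ L i)
    (hat : a ≠ t) : L i ⊆ N.closure {t, a} := by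
  have hb : N.IsBasis {t, a} (L i) := (h.indep_pair' (h.tip_mem i) ha).isBasis_of_eRk_ge
    (by simp) (by rintro x (rfl | rfl); exacts [h.tip_mem i, ha])
    (by rw [(h.indep_pair' (h.tip_mem i) ha).eRk_eq_encard, Set.encard_pair hat.symm, h.eRk_eq])
    (h.subset_ground i)
  exact hb.subset_closure

/-- The tip together with one further element from each of fewer than `r` legs is independent. -/
theorem indep_transversal (h : IsLegFamily N r t L) (S : Finset (Fin r)) (hS : S.Nonempty)
    (hSr : S.card < r) {a : Fin r → E} (ha : ∀ i ∈ S, a i ∈ L i) (hat : ∀ i ∈ S, a i ≠ t) :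
    N.Indep (insert t (a '' S)) := by
  have hfin : (insert t (a '' (S : Set (Fin r)))).Finite := (S.finite_toSet.image a).insert t
  rw [Matroid.indep_iff_eRk_eq_encard_of_finite hfin]
  refine le_antisymm (N.eRk_le_encard _) ?_
  -- At most `|S| + 1` elements span a set of rank `|S| + 1`, because the tip and one further
  -- element span a leg.
  calc (insert t (a '' (S : Set (Fin r)))).encard ≤ (a '' (S : Set (Fin r))).encard + 1 :=
        Set.encard_insert_le _ _
    _ ≤ S.card + 1 := by
        gcongr
        exact (Set.encard_image_le _ _).trans (Set.encard_coe_eq_coe_finsetCard S).le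
    _ = N.eRk (⋃ i ∈ S, L i) := (h.eRk_biUnion S hS hSr).symm
    _ ≤ N.eRk (N.closure (insert t (a '' (S : Set (Fin r))))) := N.eRk_mono (by
        refine Set.iUnion₂_subset fun i hi => (h.subset_closure (ha i hi) (hat i hi)).trans ?_
        refine N.closure_subset_closure (Set.insert_subset_insert ?_)
        rw [Set.singleton_subset_iff]
        exact ⟨i, hi, rfl⟩)
    _ = _ := N.eRk_closure_eq _

/-- Already `r - 1` legs have rank `r`, which bounds the rank of all the legs together. -/
theorem subset_closure_others (h : IsLegFamily N r t L) (hr : 2 ≤ r) (i : Fin r) :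
    L i ⊆ N.closure (⋃ j ≠ i, L j) := by
  have hU : (⋃ j ≠ i, L j) = ⋃ j ∈ ({i}ᶜ : Finset (Fin r)), L j := by simp
  have hcard : ({i}ᶜ : Finset (Fin r)).card = r - 1 := by
    rw [Finset.card_compl, Fintype.card_fin, Finset.card_singleton]
  have hrk : N.eRk (⋃ j ≠ i, L j) = r := by
    rw [hU, h.eRk_biUnion _ (by rw [← Finset.card_pos]; omega) (by omega), hcard]
    norm_cast; omega
  have hfin : N.IsRkFinite (⋃ j ≠ i, L j) := by
    rw [← Matroid.eRk_ne_top_iff, hrk]; simp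
  rw [hfin.closure_eq_closure_of_subset_of_eRk_ge_eRk (Y := ⋃ j, L j)
    (Set.iUnion₂_subset fun j _ => Set.subset_iUnion L j) (by rw [hrk]; exact h.eRk_iUnion_le)]
  exact (Set.subset_iUnion L i).trans
    (N.subset_closure _ (Set.iUnion_subset h.subset_ground))

end IsLegFamily

/-- The graph argument uses transversals of up to four legs, and these are known to be independent
only for fewer than `r` legs; hence `5 ≤ r`. -/
theorem GainFunction.IsFrameMatroid.not_isLegFamily {V : Type u} {G : Graph V E} {Γ : Type w}
    [Group Γ] {ψ : GainFunction G Γ} (hN : ψ.IsFrameMatroid N) {r : ℕ} (hr : 5 ≤ r) {t : E}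
    {L : Fin r → Set E} : ¬ IsLegFamily N r t L := by
  classical
  intro h
  refine hN.false_of_legs hr h.exists_eq h.isCircuit
    (fun i j hij a hai haj => h.eq_tip (by omega) hij hai haj) ?_ ?_ ?_
    (h.subset_closure_others (by omega))
  · intro i j hij a ha b hb hat hbt
    have := h.indep_transversal {i, j} (by simp) (by have := Finset.card_le_two (a := i) (b := j); omega)
      (a := fun x => if x = i then a else b) (by simp [ha, hb, hij.symm])
      (by simp [hat, hbt, hij.symm])
    refine this.subset ?_
    simp [Set.image_insert_eq, hij.symm]
  · intro i j k hij hik hjk a ha b hb c hc hat hbt hct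
    have := h.indep_transversal {i, j, k} (by simp)
      (by have := Finset.card_le_three (a := i) (b := j) (c := k); omega)
      (a := fun x => if x = i then a else if x = j then b else c)
      (by simp [ha, hb, hc, hij.symm, hik.symm, hjk.symm])
      (by simp [hat, hbt, hct, hij.symm, hik.symm, hjk.symm])
    refine this.subset ?_
    simp [Set.image_insert_eq, hij.symm, hik.symm, hjk.symm]
  · intro i j k l hij hik hil hjk hjl hkl a ha b hb c hc d hd hat hbt hct hdt
    have := h.indep_transversal {i, j, k, l} (by simp)
      (by have := Finset.card_le_four (a := i) (b := j) (c := k) (d := l); omega)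
      (a := fun x => if x = i then a else if x = j then b else if x = k then c else d)
      (by simp [ha, hb, hc, hd, hij.symm, hik.symm, hjk.symm, hil.symm, hjl.symm, hkl.symm])
      (by simp [hat, hbt, hct, hdt, hij.symm, hik.symm, hjk.symm, hil.symm, hjl.symm, hkl.symm])
    refine this.subset ?_
    simp [Set.image_insert_eq, hij.symm, hik.symm, hjk.symm, hil.symm, hjl.symm, hkl.symm]

/-- A rank-preserving injection carries the legs of a spike to a family of legs. -/
theorem IsSpike.exists_isLegFamily {α : Type u} {M : Matroid α} {r : ℕ} (h : IsSpike r M)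
    {f : α → E} (hf : Set.InjOn f M.E) (hrk : ∀ X ⊆ M.E, N.eRk (f '' X) = M.eRk X) :
    ∃ t L, IsLegFamily N r t L := by
  obtain ⟨-, hs, hr, t, L, -, hL, hU⟩ := h
  have hLE : ∀ i, L i ⊆ M.E := fun i => (hL i).2.1.subset_ground
  refine ⟨f t, fun i => f '' L i, fun i => ⟨t, (hL i).1, rfl⟩, ?_, ?_, ?_, ?_, ?_⟩
  · intro i
    rw [(hf.mono (hLE i)).encard_image, (hL i).2.2.2]
  · intro i
    rw [hrk _ (hLE i), (hL i).2.2.1]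
  · simp only [← Set.image_iUnion]
    rintro _ ⟨a, ha, rfl⟩ _ ⟨b, hb, rfl⟩
    have ha' := Set.iUnion_subset hLE ha
    have hb' := Set.iUnion_subset hLE hb
    have hab : ({a, b} : Set α) ⊆ M.E := by rintro x (rfl | rfl) <;> assumption
    rw [Matroid.indep_iff_eRk_eq_encard_of_finite (by simp), ← Set.image_pair, hrk _ hab,
      (hf.mono hab).encard_image, (hs a ha' b hb').eRk_eq_encard]
  · intro S hS hSr
    rw [← hU S hS hSr, ← hrk _ (Set.iUnion₂_subset fun i _ => hLE i), Set.image_iUnion₂]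
  · rw [← Set.image_iUnion, hrk _ (Set.iUnion_subset hLE), ← hr]
    exact M.eRk_le_eRank _

end Legs

/-! ### Direct sums inside elementary lifts. -/

section DirectSum

variable {α : Type u} {β : Type v} {M : Matroid α}

/-- Extends the bijection of ground sets to all of `α`, so that ranks can be transported along
`Matroid.map`. Nonemptiness provides a value off the ground set. -/
theorem MatroidIso.exists_map_eq {L : Matroid β} (h : MatroidIso M L) (hne : M.E.Nonempty) :
    ∃ (g : α → β) (hg : Set.InjOn g M.E), M.map g hg = L := by
  classical
  obtain ⟨f, hf⟩ := h
  obtain ⟨a₀, ha₀⟩ := hne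
  let g : α → β := fun a => if h : a ∈ M.E then f ⟨a, h⟩ else f ⟨a₀, ha₀⟩
  have hgE : ∀ a (h : a ∈ M.E), g a = f ⟨a, h⟩ := fun a h => dif_pos h
  have hg : Set.InjOn g M.E := by
    intro a ha b hb hab
    rw [hgE a ha, hgE b hb] at hab
    exact congrArg Subtype.val (f.injective (Subtype.ext hab))
  have himg : g '' M.E = L.E := by
    ext b
    constructor
    · rintro ⟨a, ha, rfl⟩
      rw [hgE a ha]; exact (f ⟨a, ha⟩).2
    · intro hb
      refine ⟨f.symm ⟨b, hb⟩, (f.symm ⟨b, hb⟩).2, ?_⟩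
      rw [hgE _ (f.symm ⟨b, hb⟩).2]; simp
  refine ⟨g, hg, Matroid.ext_indep himg fun I hI => ?_⟩
  have hIL : I ⊆ L.E := himg ▸ hI
  rw [Matroid.map_indep_iff, ← hf, Matroid.mapSetEquiv_indep_iff]
  set J : Set α := ↑(f.symm '' (Subtype.val ⁻¹' I : Set L.E)) with hJ
  have hJE : J ⊆ M.E := by rintro _ ⟨x, -, rfl⟩; exact x.2
  have hgJ : g '' J = I := by
    ext b
    constructor
    · rintro ⟨_, ⟨_, ⟨y, hy, rfl⟩, rfl⟩, rfl⟩
      rw [hgE _ (f.symm y).2]; simpa using hy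
    · intro hb
      refine ⟨f.symm ⟨b, hIL hb⟩, ⟨_, ⟨⟨b, hIL hb⟩, hb, rfl⟩, rfl⟩, ?_⟩
      rw [hgE _ (f.symm ⟨b, hIL hb⟩).2]; simp
  constructor
  · rintro ⟨I₀, hI₀, rfl⟩
    refine ⟨?_, hIL⟩
    rwa [(hg.image_eq_image_iff hJE hI₀.subset_ground).1 hgJ]
  · exact fun h => ⟨J, h.1, hgJ.symm⟩

theorem eRk_sum (M : Matroid α) (N : Matroid β) {X : Set α} {Y : Set β} (hX : X ⊆ M.E)
    (hY : Y ⊆ N.E) : (M.sum N).eRk (Sum.inl '' X ∪ Sum.inr '' Y) = M.eRk X + N.eRk Y := by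
  obtain ⟨I, hI⟩ := M.exists_isBasis X
  obtain ⟨J, hJ⟩ := N.exists_isBasis Y
  have hb : (M.sum N).IsBasis (Sum.inl '' I ∪ Sum.inr '' J) (Sum.inl '' X ∪ Sum.inr '' Y) := by
    rw [Matroid.sum_isBasis_iff]
    simp only [Set.preimage_union, Set.preimage_image_eq _ Sum.inl_injective,
      Set.preimage_image_eq _ Sum.inr_injective, Set.preimage_inl_image_inr,
      Set.preimage_inr_image_inl, Set.union_empty, Set.empty_union]
    exact ⟨hI, hJ⟩
  rw [← hb.encard_eq_eRk, Set.encard_union_eq (by simp [Set.disjoint_left]),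
    Sum.inl_injective.encard_image, Sum.inr_injective.encard_image, hI.encard_eq_eRk,
    hJ.encard_eq_eRk]

/-- If the ranks of two sets add up in an elementary lift of `N`, then the lift does not raise
the rank of both. -/
theorem IsLiftBy.good_or_good {N L : Matroid β} {𝒞 : Set (Set β)} (h : IsLiftBy N 𝒞 L)
    (hfin : N.E.Finite) {A B : Set β} (hA : A ⊆ N.E) (hB : B ⊆ N.E)
    (hadd : ∀ X ⊆ A, ∀ Y ⊆ B, L.eRk (X ∪ Y) = L.eRk X + L.eRk Y) :
    (∀ C ⊆ A, N.IsCircuit C → C ∈ 𝒞) ∨ (∀ C ⊆ B, N.IsCircuit C → C ∈ 𝒞) := by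
  by_contra! hcon
  obtain ⟨hcA, hcB⟩ := hcon
  obtain ⟨C, hCA, hC, hC𝒞⟩ := hcA
  obtain ⟨D, hDB, hD, hD𝒞⟩ := hcB
  have hCD := hadd C hCA D hDB
  have bad : ∀ X ⊆ N.E, ∀ K ⊆ X, N.IsCircuit K → K ∉ 𝒞 → L.eRk X = N.eRk X + 1 :=
    fun X hX K hK hKc hK𝒞 => (h.2 X hX).2 fun hgood => hK𝒞 (hgood K hK hKc)
  -- The lifted rank of `C ∪ D` is at most `N.eRk C + N.eRk D + 1`, whereas additivity demands
  -- `N.eRk C + N.eRk D + 2`.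
  rw [bad _ (Set.union_subset (hCA.trans hA) (hDB.trans hB)) C Set.subset_union_left hC hC𝒞,
    bad C (hCA.trans hA) C subset_rfl hC hC𝒞, bad D (hDB.trans hB) D subset_rfl hD hD𝒞] at hCD
  have hle := N.eRk_union_le_eRk_add_eRk C D
  have hf : ∀ X ⊆ N.E, ∃ n : ℕ, N.eRk X = n := fun X hX =>
    ENat.ne_top_iff_exists.1 (ne_top_of_le_ne_top (by
      exact (Set.encard_lt_top_iff.2 (hfin.subset hX)).ne) (N.eRk_le_encard X)) |>.imp
      fun _ h => h.symm
  obtain ⟨a, ha⟩ := hf C (hCA.trans hA)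
  obtain ⟨b, hb⟩ := hf D (hDB.trans hB)
  obtain ⟨c, hc⟩ := hf (C ∪ D) (Set.union_subset (hCA.trans hA) (hDB.trans hB))
  rw [ha, hb, hc] at hle hCD
  norm_cast at hle hCD
  omega

/-- On one of the two copies of `M` the lift raises no rank, so this copy embeds in the frame
matroid with its ranks, and its legs form a forbidden leg family. -/
theorem IsSpike.not_inClass_sum {Γ : Type w} [Group Γ] (Γ₁ : Subgroup Γ) [Γ₁.Normal]
    (𝒜 : Set (Subgroup Γ)) {r : ℕ} (hr : 5 ≤ r) (hM : IsSpike r M) :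
    ¬ InClass Γ₁ 𝒜 (M.sum M) := by
  rintro ⟨V, E, G, ψ, L, -, hE, ⟨N, hN, hL⟩, hiso⟩
  have hMne : M.E.Nonempty := by
    rw [← Set.encard_pos, hM.1]; exact_mod_cast Nat.succ_pos _
  obtain ⟨g, hg, rfl⟩ := hiso.exists_map_eq (by
    rw [Matroid.sum_ground]; exact (hMne.image _).inl)
  have hsum : ∀ {X Y : Set α}, X ⊆ M.E → Y ⊆ M.E →
      Sum.inl '' X ∪ Sum.inr '' Y ⊆ (M.sum M).E := by
    intro X Y hX hY
    rw [Matroid.sum_ground]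
    exact Set.union_subset_union (Set.image_mono hX) (Set.image_mono hY)
  have hNE : N.E = g '' (M.sum M).E := hL.1.symm
  have hrk : ∀ {X Y : Set α}, X ⊆ M.E → Y ⊆ M.E →
      ((M.sum M).map g hg).eRk (g '' (Sum.inl '' X ∪ Sum.inr '' Y)) = M.eRk X + M.eRk Y :=
    fun hX hY => by rw [Matroid.eRk_map _ hg (hsum hX hY), eRk_sum _ _ hX hY]
  have hl : ∀ {X : Set α}, X ⊆ M.E →
      ((M.sum M).map g hg).eRk ((g ∘ Sum.inl) '' X) = M.eRk X := by
    intro X hX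
    have := hrk hX (Set.empty_subset _)
    rw [Set.image_comp]
    simpa using this
  have hr' : ∀ {X : Set α}, X ⊆ M.E →
      ((M.sum M).map g hg).eRk ((g ∘ Sum.inr) '' X) = M.eRk X := by
    intro X hX
    have := hrk (Set.empty_subset _) hX
    rw [Set.image_comp]
    simpa using this
  have hA : (g ∘ Sum.inl) '' M.E ⊆ N.E := by
    rw [hNE, Set.image_comp, Matroid.sum_ground]; exact Set.image_mono Set.subset_union_left
  have hB : (g ∘ Sum.inr) '' M.E ⊆ N.E := by
    rw [hNE, Set.image_comp, Matroid.sum_ground]; exact Set.image_mono Set.subset_union_right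
  have hinl : Set.InjOn (g ∘ Sum.inl) M.E := fun a ha b hb hab => Sum.inl_injective
    (hg (by simpa using ha) (by simpa using hb) hab)
  have hinr : Set.InjOn (g ∘ Sum.inr) M.E := fun a ha b hb hab => Sum.inr_injective
    (hg (by simpa using ha) (by simpa using hb) hab)
  have hgood := hL.good_or_good (hN.1 ▸ hE) hA hB (by
    intro X hX Y hY
    obtain ⟨X, hXM, rfl⟩ := Set.subset_image_iff.1 hX
    obtain ⟨Y, hYM, rfl⟩ := Set.subset_image_iff.1 hY
    rw [hl hXM, hr' hYM, ← hrk hXM hYM, Set.image_union, Set.image_comp, Set.image_comp])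
  rcases hgood with h | h
  · obtain ⟨t, L, hleg⟩ := hM.exists_isLegFamily hinl (N := N) fun X hX => by
      rw [← hl hX, (hL.2 _ ((Set.image_mono hX).trans hA)).1
        fun C hC => h C (hC.trans (Set.image_mono hX))]
    exact hN.not_isLegFamily hr hleg
  · obtain ⟨t, L, hleg⟩ := hM.exists_isLegFamily hinr (N := N) fun X hX => by
      rw [← hr' hX, (hL.2 _ ((Set.image_mono hX).trans hB)).1
        fun C hC => h C (hC.trans (Set.image_mono hX))]
    exact hN.not_isLegFamily hr hleg

end DirectSum

end GainMatroid

/-! ### Cycles are minimal among nonempty sets without pendant edges. -/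

namespace GainMatroid

section Minimality

variable {V : Type u} {E : Type v} {G : Graph V E}

/-- The first vertex of a path meets only the first edge, which would be pendant in `D`; remove it
and repeat. -/
theorem GWalk.IsPath.eq_empty_of_noPendant {D : Set E} (hD : NoPendant G D) :
    ∀ {x y : V} {p : GWalk G x y}, p.IsPath → D ⊆ p.edgeSet → D = ∅
  | _, _, .nil _, _, h => by simpa [edgeSet, edges] using h
  | x, _, .cons (y := y) e he p, hp, h => by
    simp only [IsPath, support, List.nodup_cons] at hp
    refine IsPath.eq_empty_of_noPendant hD (p := p) hp.2 fun f hf => ?_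
    have hsub : ∀ g ∈ D, g = e ∨ g ∈ p.edges := fun g hg => by
      simpa [edgeSet, edges] using h hg
    refine (hsub f hf).resolve_left ?_
    rintro rfl
    have hyx : y ≠ x := by rintro rfl; exact hp.1 p.start_mem_support
    obtain ⟨g, hg, hgf, hgx⟩ := hD f hf x ⟨y, hyx, he⟩
    exact hp.1 (p.mem_support_of_inc ((hsub g hg).resolve_left hgf) hgx)

/-- Here `e` is the edge by which `D` arrives at the start of the path. Since `e` is not pendant
there, the first edge of the path is in `D`, and it takes the role of `e` for the rest. -/
theorem GWalk.IsPath.edges_subset_of_noPendant {D : Set E} (hD : NoPendant G D) :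
    ∀ {y x : V} {p : GWalk G y x}, p.IsPath → ∀ e ∈ D, (y ≠ x → G.IsNonloopAt e y) →
      (∀ f ∈ D, ∀ z ∈ p.support, z ≠ x → G.Inc f z → f ∈ p.edges ∨ (f = e ∧ z = y)) →
      p.edgeSet ⊆ D
  | _, _, .nil _, _, _, _, _, _ => by simp [edgeSet, edges]
  | y, x, .cons (y := z) e' he' p, hp, e, heD, hey, h => by
    simp only [IsPath, support, List.nodup_cons] at hp
    have hyx : y ≠ x := by rintro rfl; exact hp.1 p.end_mem_support
    have hzy : z ≠ y := by rintro rfl; exact hp.1 p.start_mem_support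
    have he'D : e' ∈ D := by
      obtain ⟨f, hf, hfe, hfy⟩ := hD e heD y (hey hyx)
      rcases h f hf y (by simp [support]) hyx hfy with h | h
      · simp only [edges, List.mem_cons] at h
        rcases h with rfl | h
        · exact hf
        · exact absurd (p.mem_support_of_inc h hfy) hp.1
      · exact absurd h.1 hfe
    have ih := IsPath.edges_subset_of_noPendant hD (p := p) hp.2 e' he'D
      (fun _ => ⟨y, hzy.symm, he'.symm⟩) (by
        intro f hf v hv hvx hfv
        have hvy : v ≠ y := by rintro rfl; exact hp.1 hv
        rcases h f hf v (by simp [support, hv]) hvx hfv with h | h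
        · simp only [edges, List.mem_cons] at h
          rcases h with rfl | h
          · exact Or.inr ⟨rfl, (hfv.eq_or_eq_of_isLink he').resolve_left hvy⟩
          · exact Or.inl h
        · exact absurd h.2 hvy)
    intro f hf
    simp only [edgeSet, edges, List.mem_cons, Set.mem_ofPred_eq] at hf
    rcases hf with rfl | hf
    exacts [he'D, ih hf]

/-- A cycle contains no smaller nonempty set without pendant edges. -/
theorem IsCycleSet.eq_of_noPendant {C D : Set E} (hC : IsCycleSet G C) (hD : NoPendant G D)
    (hne : D.Nonempty) (hDC : D ⊆ C) : D = C := by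
  obtain ⟨x, p, ⟨hp0, hpe, hps⟩, rfl⟩ := hC
  cases p with
  | nil h => simp [GWalk.edges] at hp0
  | @cons _ y _ e he p =>
    simp only [GWalk.support, List.tail_cons] at hps
    have hsub : ∀ g ∈ D, g = e ∨ g ∈ p.edges := fun g hg => by
      simpa [GWalk.edgeSet, GWalk.edges] using hDC hg
    by_cases heD : e ∈ D
    · refine hDC.antisymm ?_
      have key := GWalk.IsPath.edges_subset_of_noPendant hD (p := p) hps e heD
        (fun hyx => ⟨x, hyx.symm, he.symm⟩) (by
          intro f hf z hz hzx hfz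
          rcases hsub f hf with rfl | h
          · exact Or.inr ⟨rfl, (hfz.eq_or_eq_of_isLink he).resolve_left hzx⟩
          · exact Or.inl h)
      intro f hf
      simp only [GWalk.edgeSet, GWalk.edges, List.mem_cons, Set.mem_ofPred_eq] at hf
      rcases hf with rfl | hf
      exacts [heD, key hf]
    · have := GWalk.IsPath.eq_empty_of_noPendant hD (p := p) hps fun f hf =>
        (hsub f hf).resolve_left (by rintro rfl; exact heD hf)
      exact absurd this hne.ne_empty

theorem IsCycleSet.nonempty {C : Set E} (hC : IsCycleSet G C) : C.Nonempty := by
  obtain ⟨x, p, hp, rfl⟩ := hC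
  exact List.exists_mem_of_ne_nil _ hp.1

/-- Two of the three paths of a theta form a nonempty proper subset without pendant edges. -/
theorem IsCycleSet.not_isTheta {C : Set E} (hC : IsCycleSet G C) : ¬ IsTheta G C := by
  rintro ⟨x, y, p, hxy, hp, hd, rfl⟩
  obtain ⟨e, he, -⟩ := (p 0).exists_inc_start_of_ne hxy
  obtain ⟨f, hf, -⟩ := (p 1).exists_inc_start_of_ne hxy
  have h := hC.eq_of_noPendant ((hp 1).noPendant_union (hp 2) hxy (hd 1 2 (by simp)).1)
    ⟨f, Or.inl hf⟩ (Set.union_subset (Set.subset_iUnion (fun i => (p i).edgeSet) 1)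
      (Set.subset_iUnion (fun i => (p i).edgeSet) 2))
  have he' : e ∈ (p 1).edgeSet ∪ (p 2).edgeSet := h ▸ Set.mem_iUnion.2 ⟨0, he⟩
  rcases he' with he' | he'
  · exact Set.disjoint_left.1 (hd 0 1 (by simp)).1 he he'
  · exact Set.disjoint_left.1 (hd 0 2 (by simp)).1 he he'

theorem IsHandcuff.exists_ssubset {C : Set E} (hC : IsHandcuff G C) :
    ∃ D, IsCycleSet G D ∧ D ⊂ C := by
  have key : ∀ C₁ C₂ : Set E, IsCycleSet G C₁ → IsCycleSet G C₂ → Disjoint C₁ C₂ →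
      C₁ ∪ C₂ ⊆ C → ∃ D, IsCycleSet G D ∧ D ⊂ C := by
    intro C₁ C₂ h₁ h₂ hd hsub
    refine ⟨C₁, h₁, Set.subset_union_left.trans hsub, fun h => ?_⟩
    obtain ⟨e, he⟩ := h₂.nonempty
    exact Set.disjoint_left.1 hd (h (hsub (Or.inr he))) he
  rcases hC with ⟨C₁, C₂, h₁, h₂, hd, -, rfl⟩ | ⟨C₁, C₂, x, y, p, h₁, h₂, hd, hp, hpx, hpy, rfl⟩
  · exact key C₁ C₂ h₁ h₂ hd subset_rfl
  · refine key C₁ C₂ h₁ h₂ (Set.disjoint_left.2 fun e he he' => ?_) Set.subset_union_left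
    obtain ⟨z, q, -, rfl⟩ := h₁
    obtain ⟨a, b, hab⟩ := G.exists_isLink_of_mem_edgeSet (q.mem_edgeSet_graph he)
    exact Set.disjoint_left.1 hd ⟨e, he, hab.inc_left⟩ ⟨e, he', hab.inc_left⟩

theorem IsCycleSet.not_isHandcuff {C : Set E} (hC : IsCycleSet G C) : ¬ IsHandcuff G C := by
  intro h
  obtain ⟨D, hD, hDC⟩ := h.exists_ssubset
  exact hDC.ne (hC.eq_of_noPendant hD.noPendant hD.nonempty hDC.subset)

end Minimality

/-! ### Gains of walks along which a potential exists. -/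

namespace GainFunction

variable {V : Type u} {E : Type v} {G : Graph V E} {Γ : Type w} [Group Γ]
  {ψ : GainFunction G Γ} {η : V → Γ}

theorem IsFrameCircuit.nonempty {C : Set E} (h : ψ.IsFrameCircuit C) : C.Nonempty := by
  rcases h with h | ⟨h | h, -⟩
  · exact h.isCycleSet.nonempty
  · obtain ⟨D, hD, hDC⟩ := h.exists_ssubset
    exact hD.nonempty.mono hDC.subset
  · obtain ⟨x, y, p, hxy, -, -, rfl⟩ := h
    obtain ⟨e, he, -⟩ := (p 0).exists_inc_start_of_ne hxy
    exact ⟨e, Set.mem_iUnion.2 ⟨0, he⟩⟩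

theorem walkGain_of_potential : ∀ {x y : V} (p : GWalk G x y),
    (∀ e ∈ p.edges, ∀ a b, G.IsLink e a b → ψ.val e a b = (η a)⁻¹ * η b) →
      ψ.walkGain p = (η x)⁻¹ * η y
  | _, _, .nil _, _ => by simp [walkGain]
  | _, _, .cons e he p, h => by
    rw [walkGain, h e (by simp [GWalk.edges]) _ _ he,
      walkGain_of_potential p fun f hf => h f (by simp [GWalk.edges, hf])]
    group

/-- The product telescopes except at the single passage through `e₀`, which contributes `k` or `k⁻¹`
according to its direction. -/
theorem exists_walkGain_of_potential {e₀ : E} {k : Γ}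
    (h₀ : ∀ a b, G.IsLink e₀ a b → ∃ δ, (δ = k ∨ δ = k⁻¹) ∧ ψ.val e₀ a b = (η a)⁻¹ * δ * η b) :
    ∀ {x y : V} (p : GWalk G x y), p.edges.Nodup → e₀ ∈ p.edges →
      (∀ e ∈ p.edges, e ≠ e₀ → ∀ a b, G.IsLink e a b → ψ.val e a b = (η a)⁻¹ * η b) →
      ∃ δ, (δ = k ∨ δ = k⁻¹) ∧ ψ.walkGain p = (η x)⁻¹ * δ * η y
  | _, _, .nil _, _, h, _ => by simp [GWalk.edges] at h
  | _, _, .cons e he p, hnd, hmem, h => by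
    simp only [GWalk.edges, List.nodup_cons, List.mem_cons] at hnd hmem
    by_cases hee : e = e₀
    · subst hee
      obtain ⟨δ, hδ, hval⟩ := h₀ _ _ he
      refine ⟨δ, hδ, ?_⟩
      rw [walkGain, hval, walkGain_of_potential p fun f hf => h f (by simp [GWalk.edges, hf])
        (by rintro rfl; exact hnd.1 hf)]
      group
    · obtain ⟨δ, hδ, hp⟩ := exists_walkGain_of_potential h₀ p hnd.2
        (hmem.resolve_left (Ne.symm hee)) fun f hf => h f (by simp [GWalk.edges, hf])
      refine ⟨δ, hδ, ?_⟩
      rw [walkGain, hp, h e (by simp [GWalk.edges]) hee _ _ he]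
      group

/-- If a balanced cycle has a potential off one edge, then the gain of that edge after switching
by the potential is trivial. -/
theorem IsBalancedCycle.eq_one_of_potential {C : Set E} (hC : ψ.IsBalancedCycle C) {e₀ : E}
    {k : Γ} (he₀ : e₀ ∈ C) (η : V → Γ)
    (h₀ : ∀ a b, G.IsLink e₀ a b → ∃ δ, (δ = k ∨ δ = k⁻¹) ∧ ψ.val e₀ a b = (η a)⁻¹ * δ * η b)
    (h : ∀ e ∈ C, e ≠ e₀ → ∀ a b, G.IsLink e a b → ψ.val e a b = (η a)⁻¹ * η b) : k = 1 := by
  obtain ⟨x, p, hp, rfl, hgain⟩ := hC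
  obtain ⟨δ, hδ, hp'⟩ := exists_walkGain_of_potential h₀ p hp.2.1 he₀ h
  rw [hgain] at hp'
  have : δ = 1 := by
    have h1 : η x * 1 * (η x)⁻¹ = δ := by rw [hp']; group
    rw [← h1]; group
  rcases hδ with rfl | rfl
  · exact this
  · simpa using this

theorem walkGain_quot_eq_one (Γ₁ : Subgroup Γ) [Γ₁.Normal] (h : ∀ e a b, ψ.val e a b ∈ Γ₁) :
    ∀ {x y : V} (p : GWalk G x y), (ψ.quot Γ₁).walkGain p = 1
  | _, _, .nil _ => rfl
  | x, _, .cons (y := y) e he p => by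
    rw [walkGain, walkGain_quot_eq_one Γ₁ h p, mul_one]
    exact (QuotientGroup.eq_one_iff _).2 (h e x y)

end GainFunction

end GainMatroid

namespace GainMatroid

/-! ### Spikes with prescribed dependent transversals. -/

section SpikeMatroid

/-- The ground set of a spike: the tip `none` and the pairs `(i, false)`, `(i, true)`. -/
abbrev SpikeElt (r : ℕ) : Type := Option (Fin r × Bool)

variable {r : ℕ}

/-- The indices of the legs that meet `X` outside the tip. -/
def legIndices (X : Set (SpikeElt r)) : Set (Fin r) := {i | ∃ b, some (i, b) ∈ X}

/-- A set of one non-tip element from each leg. -/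
def IsTransversal (X : Set (SpikeElt r)) : Prop := none ∉ X ∧ ∀ i, ∃! b, some (i, b) ∈ X

theorem legIndices_mono {X Y : Set (SpikeElt r)} (h : X ⊆ Y) : legIndices X ⊆ legIndices Y :=
  fun _ ⟨b, hb⟩ => ⟨b, h hb⟩

theorem legIndices_union (X Y : Set (SpikeElt r)) :
    legIndices (X ∪ Y) = legIndices X ∪ legIndices Y := by
  ext i; simp only [legIndices, Set.mem_union, Set.mem_ofPred_eq]; exact exists_or

theorem legIndices_insert_some (i : Fin r) (b : Bool) (X : Set (SpikeElt r)) :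
    legIndices (insert (some (i, b)) X) = insert i (legIndices X) := by
  ext j; simp [legIndices, exists_or]

theorem legIndices_insert_none (X : Set (SpikeElt r)) :
    legIndices (insert none X) = legIndices X := by
  ext j; simp [legIndices]

theorem ncard_legIndices_le (X : Set (SpikeElt r)) : (legIndices X).ncard ≤ X.ncard := by
  have h : legIndices X = Prod.fst '' (some ⁻¹' X : Set (Fin r × Bool)) := by
    ext i; simp [legIndices]
  rw [h]
  refine (Set.ncard_image_le (Set.toFinite _)).trans ?_
  rw [← Set.ncard_image_of_injective _ (Option.some_injective _)]
  exact Set.ncard_le_ncard (Set.image_preimage_subset _ _)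

theorem IsTransversal.legIndices_eq {X : Set (SpikeElt r)} (h : IsTransversal X) :
    legIndices X = Set.univ := Set.eq_univ_of_forall fun i => (h.2 i).exists

theorem isTransversal_of_legIndices_eq {X : Set (SpikeElt r)} (hn : none ∉ X)
    (hp : ∀ i, ¬ (some (i, false) ∈ X ∧ some (i, true) ∈ X)) (hX : legIndices X = Set.univ) :
    IsTransversal X := by
  refine ⟨hn, fun i => ?_⟩
  obtain ⟨b, hb⟩ : i ∈ legIndices X := hX ▸ Set.mem_univ i
  refine ⟨b, hb, fun c hc => ?_⟩
  have := hp i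
  cases b <;> cases c <;> simp_all

theorem IsTransversal.exists_eq {X : Set (SpikeElt r)} (h : IsTransversal X) :
    ∃ s : Fin r → Bool, X = Set.range fun i => some (i, s i) := by
  choose s hs hs' using h.2
  refine ⟨s, ?_⟩
  ext (_ | ⟨i, b⟩)
  · simpa using h.1
  · simp only [Set.mem_range, Option.some.injEq, Prod.mk.injEq, exists_eq_left]
    exact ⟨fun hb => (hs' i b hb).symm, fun hb => hb ▸ hs i⟩

theorem IsTransversal.ncard_eq {X : Set (SpikeElt r)} (h : IsTransversal X) : X.ncard = r := by
  obtain ⟨s, rfl⟩ := h.exists_eq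
  have hinj : Function.Injective fun i : Fin r => (some (i, s i) : SpikeElt r) :=
    fun i j hij => by simpa using congrArg (Option.map Prod.fst) hij
  rw [← Set.image_univ, Set.ncard_image_of_injective _ hinj]
  simp

/-- The bases of the spike in which the transversals in `𝒟` are dependent. -/
def IsSpikeBase (𝒟 : Set (Set (SpikeElt r))) (B : Set (SpikeElt r)) : Prop :=
  B.ncard = r ∧ r ≤ (legIndices B).ncard + 1 ∧ B ∉ 𝒟

variable {𝒟 : Set (Set (SpikeElt r))}

/-- These sets miss leg `j`, so they are not transversals and `𝒟` cannot exclude them. They provide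
the bases needed for the independence proofs below. -/
theorem isSpikeBase_insert (h𝒟 : ∀ T ∈ 𝒟, IsTransversal T) (s : Fin r → Bool) (j : Fin r)
    {e : SpikeElt r} (he : e = none ∨ ∃ k, k ≠ j ∧ e = some (k, !s k)) :
    IsSpikeBase 𝒟 (insert e ((fun i => some (i, s i)) '' {j}ᶜ)) := by
  have hinj : Function.Injective fun i : Fin r => (some (i, s i) : SpikeElt r) :=
    fun i i' hij => by simpa using congrArg (Option.map Prod.fst) hij
  have hc : ((fun i => (some (i, s i) : SpikeElt r)) '' {j}ᶜ).ncard = r - 1 := by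
    rw [Set.ncard_image_of_injective _ hinj, Set.ncard_compl]; simp
  have hr : 0 < r := j.pos
  have hl : legIndices ((fun i => (some (i, s i) : SpikeElt r)) '' {j}ᶜ) = {j}ᶜ := by
    ext i; simp [legIndices]
  have hl' : legIndices (insert e ((fun i => (some (i, s i) : SpikeElt r)) '' {j}ᶜ)) = {j}ᶜ := by
    rcases he with rfl | ⟨k, hk, rfl⟩
    · rw [legIndices_insert_none, hl]
    · rw [legIndices_insert_some, hl]
      exact Set.insert_eq_of_mem hk
  have he' : e ∉ (fun i => (some (i, s i) : SpikeElt r)) '' {j}ᶜ := by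
    rcases he with rfl | ⟨k, hk, rfl⟩ <;> simp
  refine ⟨?_, ?_, fun h => ?_⟩
  · rw [Set.ncard_insert_of_notMem he', hc]; omega
  · rw [hl', Set.ncard_compl]; simp; omega
  · have := (h𝒟 _ h).legIndices_eq
    rw [hl'] at this
    exact (this ▸ Set.mem_univ j : j ∈ ({j}ᶜ : Set (Fin r))) rfl

/-- If `B₁ \ {a}` meets only `r - 2` legs, add an element of `B₂` on a new leg; the result still
misses a leg, so it is not in `𝒟`. Otherwise every `b ∈ B₂ \ B₁` gives enough legs, and exchange
fails only if every `insert b (B₁ \ {a})` is in `𝒟`. By `h𝒟'` there is then just one such `b`, so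
`B₂` itself would be in `𝒟`. -/
theorem exchangeProperty_isSpikeBase (h𝒟 : ∀ T ∈ 𝒟, IsTransversal T)
    (h𝒟' : ∀ (I : Set (SpikeElt r)) (e f : SpikeElt r), e ∉ I → f ∉ I →
      insert e I ∈ 𝒟 → insert f I ∈ 𝒟 → e = f) :
    Matroid.ExchangeProperty (IsSpikeBase 𝒟) := by
  rintro B₁ B₂ ⟨hc₁, hi₁, hB₁⟩ ⟨hc₂, hi₂, hB₂⟩ a ⟨ha₁, ha₂⟩
  have hcard : (B₁ \ {a}).ncard + 1 = r := by rw [Set.ncard_sdiff_singleton_add_one ha₁, hc₁]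
  have hle : (legIndices B₁).ncard ≤ (legIndices (B₁ \ {a})).ncard + 1 := by
    have h : insert a (B₁ \ {a}) = B₁ := by simp [Set.insert_eq_of_mem ha₁]
    rcases a with _ | ⟨i, b⟩
    · rw [← h, legIndices_insert_none, h]; omega
    · conv_lhs => rw [← h, legIndices_insert_some]
      exact Set.ncard_insert_le _ _
  by_cases hsmall : (legIndices (B₁ \ {a})).ncard + 1 < r
  · obtain ⟨j, ⟨b, hb⟩, hj⟩ := Set.exists_mem_notMem_of_ncard_lt_ncard
      (show (legIndices (B₁ \ {a})).ncard < (legIndices B₂).ncard by omega)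
    have hbB : some (j, b) ∉ B₁ \ {a} := fun h => hj ⟨b, h⟩
    have hidx : (legIndices (insert (some (j, b)) (B₁ \ {a}))).ncard =
        (legIndices (B₁ \ {a})).ncard + 1 := by
      rw [legIndices_insert_some, Set.ncard_insert_of_notMem hj]
    refine ⟨some (j, b), ⟨hb, fun h => hbB ⟨h, fun h' => ha₂ (h' ▸ hb)⟩⟩, ?_, ?_, fun h => ?_⟩
    · rw [Set.ncard_insert_of_notMem hbB, hcard]
    · omega
    · have h1 := (h𝒟 _ h).legIndices_eq
      rw [h1] at hidx
      simp only [Set.ncard_univ, Nat.card_eq_fintype_card, Fintype.card_fin] at hidx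
      omega
  by_contra! hcon
  have hall : ∀ b ∈ B₂ \ B₁, insert b (B₁ \ {a}) ∈ 𝒟 := by
    intro b hb
    by_contra hbD
    refine hcon b hb ⟨?_, ?_, hbD⟩
    · rw [Set.ncard_insert_of_notMem fun h => hb.2 h.1, hcard]
    · have := Set.ncard_le_ncard (legIndices_mono (Set.subset_insert b (B₁ \ {a})))
      omega
  obtain ⟨b, hb⟩ : (B₂ \ B₁).Nonempty := by
    rw [Set.sdiff_nonempty]
    intro h
    exact ha₂ (Set.eq_of_subset_of_ncard_le h (by omega) ▸ ha₁)
  have hsub : B₂ ⊆ insert b (B₁ \ {a}) := by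
    intro c hc
    by_cases hcB : c ∈ B₁
    · exact Or.inr ⟨hcB, fun h => ha₂ (h ▸ hc)⟩
    · exact Or.inl (h𝒟' _ c b (fun h => hcB h.1) (fun h => hb.2 h.1) (hall c ⟨hc, hcB⟩) (hall b hb))
  have hB : B₂ = insert b (B₁ \ {a}) := Set.eq_of_subset_of_ncard_le hsub (by
    rw [Set.ncard_insert_of_notMem fun h => hb.2 h.1, hcard, hc₂])
  exact hB₂ (hB ▸ hall b hb)

/-- `M` is the spike with tip `none` and legs `{none, (i, false), (i, true)}` in which exactly
the transversals in `𝒟` are dependent. -/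
structure IsSpikeMatroid (𝒟 : Set (Set (SpikeElt r))) (M : Matroid (SpikeElt r)) : Prop where
  ground_eq : M.E = Set.univ
  isBase_iff : ∀ B, M.IsBase B ↔ IsSpikeBase 𝒟 B
  isTransversal : ∀ T ∈ 𝒟, IsTransversal T

theorem exists_isSpikeMatroid (hr : 0 < r) (h𝒟 : ∀ T ∈ 𝒟, IsTransversal T)
    (h𝒟' : ∀ (I : Set (SpikeElt r)) (e f : SpikeElt r), e ∉ I → f ∉ I →
      insert e I ∈ 𝒟 → insert f I ∈ 𝒟 → e = f) : ∃ M, IsSpikeMatroid 𝒟 M :=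
  ⟨Matroid.ofIsBaseOfFinite (Set.finite_univ) (IsSpikeBase 𝒟)
    ⟨_, isSpikeBase_insert h𝒟 (fun _ => false) ⟨0, hr⟩ (Or.inl rfl)⟩
    (exchangeProperty_isSpikeBase h𝒟 h𝒟') (fun _ _ => Set.subset_univ _), rfl, fun _ => Iff.rfl, h𝒟⟩

end SpikeMatroid

end GainMatroid

/-! ### The spike as an elementary lift of its projection from the tip. -/

namespace GainMatroid

variable {r : ℕ} {𝒟 : Set (Set (SpikeElt r))} {M : Matroid (SpikeElt r)}

/-- The circuits of the graphic matroid obtained by projecting the spike from its tip. -/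
def IsSpikeCycle (C : Set (SpikeElt r)) : Prop :=
  C = {none} ∨ (∃ i, C = {some (i, false), some (i, true)}) ∨ IsTransversal C

theorem exists_isSpikeCycle_subset {X : Set (SpikeElt r)}
    (h : none ∈ X ∨ (∃ i, some (i, false) ∈ X ∧ some (i, true) ∈ X) ∨ legIndices X = Set.univ) :
    ∃ C ⊆ X, IsSpikeCycle C := by
  by_cases hn : none ∈ X
  · exact ⟨{none}, by simpa using hn, Or.inl rfl⟩
  by_cases hp : ∃ i, some (i, false) ∈ X ∧ some (i, true) ∈ X
  · obtain ⟨i, hi⟩ := hp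
    exact ⟨_, by rintro _ (rfl | rfl); exacts [hi.1, hi.2], Or.inr (Or.inl ⟨i, rfl⟩)⟩
  · exact ⟨X, subset_rfl, Or.inr (Or.inr (isTransversal_of_legIndices_eq hn (by simpa using hp)
      ((h.resolve_left hn).resolve_left hp)))⟩

theorem IsSpikeCycle.cases_of_subset {X C : Set (SpikeElt r)} (hC : IsSpikeCycle C) (hCX : C ⊆ X) :
    none ∈ X ∨ (∃ i, some (i, false) ∈ X ∧ some (i, true) ∈ X) ∨ legIndices X = Set.univ := by
  rcases hC with rfl | ⟨i, rfl⟩ | hC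
  · exact Or.inl (hCX rfl)
  · exact Or.inr (Or.inl ⟨i, hCX (by simp), hCX (by simp)⟩)
  · exact Or.inr (Or.inr (Set.eq_univ_of_univ_subset (hC.legIndices_eq ▸ legIndices_mono hCX)))

namespace IsSpikeMatroid

theorem mem_ground (hM : IsSpikeMatroid 𝒟 M) (e : SpikeElt r) : e ∈ M.E :=
  hM.ground_eq ▸ Set.mem_univ e

theorem subset_ground (hM : IsSpikeMatroid 𝒟 M) (X : Set (SpikeElt r)) : X ⊆ M.E :=
  hM.ground_eq ▸ Set.subset_univ X

/-- Choose on every leg met by `X` its element in `X`, anything elsewhere, and omit a leg that `X`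
misses: this with the tip is a base. -/
theorem indep_insert_none (hM : IsSpikeMatroid 𝒟 M) {X : Set (SpikeElt r)} (hn : none ∉ X)
    (hp : ∀ i, ¬ (some (i, false) ∈ X ∧ some (i, true) ∈ X)) (hX : legIndices X ≠ Set.univ) :
    M.Indep (insert none X) := by
  classical
  obtain ⟨j, hj⟩ := (Set.ne_univ_iff_exists_notMem _).1 hX
  have hB := (hM.isBase_iff _).2 (isSpikeBase_insert hM.isTransversal
    (fun i => decide (some (i, true) ∈ X)) j (e := none) (Or.inl rfl))
  refine hB.indep.subset (Set.insert_subset_insert ?_)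
  rintro (_ | ⟨i, b⟩) hb
  · exact absurd hb hn
  · refine ⟨i, fun h => hj (h ▸ ⟨b, hb⟩), ?_⟩
    have := hp i
    cases b <;> simp_all

theorem indep_pair (hM : IsSpikeMatroid 𝒟 M) (hr : 2 ≤ r) (i : Fin r) :
    M.Indep {some (i, false), some (i, true)} := by
  have : Nontrivial (Fin r) := Fin.nontrivial_iff_two_le.2 hr
  obtain ⟨j, hj⟩ := exists_ne i
  have hB := (hM.isBase_iff _).2 (isSpikeBase_insert hM.isTransversal (fun _ => false) j
    (e := some (i, true)) (Or.inr ⟨i, hj.symm, rfl⟩))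
  refine hB.indep.subset ?_
  rintro _ (rfl | rfl)
  · exact Or.inr ⟨i, hj.symm, rfl⟩
  · exact Or.inl rfl

/-- A base has at most one element more than the legs it meets, and discarding `n` elements loses at
most `n` legs. -/
theorem ncard_le_of_indep (hM : IsSpikeMatroid 𝒟 M) {I : Set (SpikeElt r)} (hI : M.Indep I) :
    I.ncard ≤ (legIndices I).ncard + 1 := by
  obtain ⟨B, hB, hIB⟩ := hI.exists_isBase_superset
  obtain ⟨hc, hi, -⟩ := (hM.isBase_iff B).1 hB
  have h1 : (legIndices B).ncard ≤ (legIndices I).ncard + (legIndices (B \ I)).ncard := by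
    have : B = I ∪ (B \ I) := (Set.union_sdiff_cancel hIB).symm
    conv_lhs => rw [this, legIndices_union]
    exact Set.ncard_union_le _ _
  have h2 := ncard_legIndices_le (B \ I)
  have h3 := Set.ncard_sdiff_add_ncard_of_subset hIB
  omega

theorem ncard_le (hM : IsSpikeMatroid 𝒟 M) {I : Set (SpikeElt r)} (hI : M.Indep I) :
    I.ncard ≤ r := by
  obtain ⟨B, hB, hIB⟩ := hI.exists_isBase_superset
  exact (Set.ncard_le_ncard hIB).trans ((hM.isBase_iff B).1 hB).1.le

theorem eRk_eq (hM : IsSpikeMatroid 𝒟 M) {X I : Set (SpikeElt r)} (hIX : I ⊆ X) (hI : M.Indep I)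
    (hc : (legIndices X).ncard + 1 ≤ I.ncard) : M.eRk X = ((legIndices X).ncard + 1 : ℕ) := by
  refine le_antisymm (Matroid.eRk_le_iff.2 fun J hJX hJ => ?_) ?_
  · rw [← Set.Finite.cast_ncard_eq (Set.toFinite J)]
    exact_mod_cast (hM.ncard_le_of_indep hJ).trans
      (Nat.add_le_add_right (Set.ncard_le_ncard (legIndices_mono hJX)) 1)
  · refine le_trans ?_ (hI.encard_le_eRk_of_subset hIX)
    rw [← Set.Finite.cast_ncard_eq (Set.toFinite I)]
    exact_mod_cast hc

theorem eRank_eq (hM : IsSpikeMatroid 𝒟 M) : M.eRank = r := by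
  obtain ⟨B, hB⟩ := M.exists_isBase
  rw [← hB.encard_eq_eRank, ← Set.Finite.cast_ncard_eq (Set.toFinite B),
    ((hM.isBase_iff B).1 hB).1]

theorem isSpike (hM : IsSpikeMatroid 𝒟 M) (hr : 3 ≤ r) : IsSpike r M := by
  classical
  let L : Fin r → Set (SpikeElt r) := fun i => {none, some (i, false), some (i, true)}
  have hrank : ∀ S : Finset (Fin r), S.card < r → S.Nonempty →
      M.eRk (⋃ i ∈ S, L i) = S.card + 1 := by
    intro S hS hne
    have hidx : legIndices (⋃ i ∈ S, L i) = S := by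
      ext j; simp [legIndices, L]
    let I : Set (SpikeElt r) := (fun i => some (i, false)) '' (S : Set (Fin r))
    have hIidx : legIndices I = S := by ext j; simp [legIndices, I]
    have hinj : Function.Injective fun i : Fin r => (some (i, false) : SpikeElt r) :=
      fun i j hij => by simpa using hij
    have hIc : I.ncard = S.card := by
      rw [Set.ncard_image_of_injective _ hinj, Set.ncard_coe_finset]
    have hI : M.Indep (insert none I) := hM.indep_insert_none (by simp [I]) (by simp [I]) (by
      rw [hIidx]
      intro h
      rw [Finset.coe_eq_univ] at h
      rw [h, Finset.card_univ, Fintype.card_fin] at hS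
      exact lt_irrefl _ hS)
    have := hM.eRk_eq (X := ⋃ i ∈ S, L i) (I := insert none I) (by
      rintro e (rfl | ⟨i, hi, rfl⟩)
      · obtain ⟨i, hi⟩ := hne
        exact Set.mem_biUnion hi (by simp [L])
      · exact Set.mem_biUnion hi (by simp [L])) hI (by
      rw [hidx, Set.ncard_coe_finset, Set.ncard_insert_of_notMem (by simp [I]), hIc])
    rw [this, hidx, Set.ncard_coe_finset]
    norm_cast
  have hrank1 : ∀ i, M.eRk (L i) = 2 := by
    intro i
    have := hrank {i} (by simp; omega) (by simp)
    simpa [one_add_one_eq_two] using this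
  have hpair : ∀ i j : Fin r, i ≠ j → ∀ b c, M.Indep {none, some (i, b), some (j, c)} := by
    intro i j hij b c
    refine hM.indep_insert_none (by simp) ?_ ?_
    · intro k; simp; grind
    · intro h
      have h1 : legIndices {some (i, b), some (j, c)} = {i, j} := by
        ext k; simp [legIndices]; grind
      have h2 := Set.ncard_pair hij
      rw [← h1, h] at h2
      simp at h2
      omega
  have : Nontrivial (Fin r) := Fin.nontrivial_iff_two_le.2 (by omega)
  have hsingle : ∀ (i : Fin r) (b : Bool), M.Indep {none, some (i, b)} := fun i b => by
    obtain ⟨j, hj⟩ := exists_ne i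
    exact (hpair i j hj.symm b b).subset (by intro; simp; tauto)
  refine ⟨?_, ?_, hM.eRank_eq, none, L, ?_, fun i => ⟨by simp [L], ?_, hrank1 i, ?_⟩, ?_⟩
  · rw [hM.ground_eq, Set.encard_univ, ENat.card_eq_coe_fintype_card]
    simp [mul_comm]
  · rintro (_ | ⟨i, b⟩) - (_ | ⟨j, c⟩) -
    · exact (hsingle ⟨0, by omega⟩ true).subset (by simp)
    · exact hsingle j c
    · rw [Set.pair_comm]; exact hsingle i b
    · by_cases hij : i = j
      · subst hij
        refine (hM.indep_pair (by omega) i).subset ?_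
        rintro _ (rfl | rfl)
        · cases b <;> simp
        · cases c <;> simp
      · exact (hpair i j hij b c).subset (by intro; simp; tauto)
  · intro i j hij
    have : some (i, false) ∈ L j := hij ▸ (by simp [L] : some (i, false) ∈ L i)
    simpa [L] using this
  · rw [Matroid.isFlat_iff_closure_eq]
    refine (M.subset_closure _ (hM.subset_ground _)).antisymm' ?_
    rintro (_ | ⟨j, b⟩) he
    · simp [L]
    by_contra hj
    have hij : i ≠ j := by rintro rfl; cases b <;> simp [L] at hj
    have hI := hpair i j hij false b
    -- An element of another leg in the closure would put an independent triple into a set of rank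
    -- 2.
    have hle := hI.encard_le_eRk_of_subset (X := M.closure (L i)) (by
      rintro _ (rfl | rfl | rfl)
      · exact M.mem_closure_of_mem' (by simp [L]) (hM.mem_ground _)
      · exact M.mem_closure_of_mem' (by simp [L]) (hM.mem_ground _)
      · exact he)
    rw [Matroid.eRk_closure_eq, hrank1, Set.encard_insert_of_notMem (by simp),
      Set.encard_pair (by simp [hij])] at hle
    norm_num at hle
  · rw [Set.encard_insert_of_notMem (by simp), Set.encard_pair (by simp)]
    norm_num
  · exact fun S hS hSr => hrank S hSr hS

/-- The projection of a spike from its tip, with the tip kept as a loop. -/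
theorem exists_projection (hM : IsSpikeMatroid 𝒟 M) (hr : 2 ≤ r) :
    ∃ N : Matroid (SpikeElt r), N.E = Set.univ ∧
      (∀ X, N.Indep X ↔ ∀ C ⊆ X, ¬ IsSpikeCycle C) ∧
      ∀ X, N.eRk X + 1 = M.eRk (insert none X) := by
  have ht : M.Indep {none} := by
    simpa using hM.indep_insert_none (X := ∅) (by simp) (by simp) (by
      have : legIndices (∅ : Set (SpikeElt r)) = ∅ := by ext; simp [legIndices]
      rw [this]
      have : Nonempty (Fin r) := ⟨⟨0, by omega⟩⟩
      exact Set.empty_ne_univ)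
  -- Contraction removes the tip from the ground set; restricting to `Set.univ` puts it back as a
  -- loop.
  have hN : ∀ X, ((M.contract {none}).restrict Set.univ).Indep X ↔ none ∉ X ∧ M.Indep (insert none X) := by
    intro X
    rw [Matroid.restrict_indep_iff, ht.contract_indep_iff, Set.disjoint_singleton_right,
      Set.union_singleton]
    simp
  refine ⟨(M.contract {none}).restrict Set.univ, rfl, fun X => ?_, fun X => ?_⟩
  · rw [hN]
    constructor
    · rintro ⟨hn, hI⟩ C hCX hC
      have hc := hM.ncard_le_of_indep hI
      have hcr := hM.ncard_le hI
      rw [Set.ncard_insert_of_notMem hn] at hc hcr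
      rw [legIndices_insert_none] at hc
      rcases hC.cases_of_subset hCX with h | ⟨i, hf, ht⟩ | h
      · exact hn h
      · have h1 : legIndices (X \ {some (i, true)}) = legIndices X := by
          refine (legIndices_mono Set.sdiff_subset).antisymm ?_
          rintro j ⟨b, hb⟩
          by_cases hj : j = i
          · subst hj; exact ⟨false, hf, by simp⟩
          · exact ⟨b, hb, by simp [hj]⟩
        have h2 := ncard_legIndices_le (X \ {some (i, true)})
        have h3 := Set.ncard_sdiff_singleton_add_one ht
        rw [h1] at h2
        omega
      · have h1 := ncard_legIndices_le X
        rw [h, Set.ncard_univ, Nat.card_eq_fintype_card, Fintype.card_fin] at h1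
        omega
    · intro h
      have hnot := mt exists_isSpikeCycle_subset (by push Not; exact h)
      push Not at hnot
      exact ⟨hnot.1, hM.indep_insert_none hnot.1 (fun i hi => hnot.2.1 i hi.1 hi.2) hnot.2.2⟩
  · obtain ⟨I, hI⟩ := ((M.contract {none}).restrict Set.univ).exists_isBasis X (Set.subset_univ _)
    have hI' := (hN I).1 hI.indep
    have hb : M.IsBasis (insert none I) (insert none X) := by
      refine hI'.2.isBasis_of_forall_insert (Set.insert_subset_insert hI.subset) ?_
      rintro e ⟨he, heI⟩
      have hen : e ≠ none := by rintro rfl; exact heI (by simp)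
      have heX : e ∈ X := he.resolve_left hen
      rw [Matroid.dep_iff]
      refine ⟨fun h => ?_, hM.subset_ground _⟩
      rw [Set.insert_comm] at h
      have hmem := hI.mem_of_insert_indep heX ((hN _).2 ⟨by simp [hen.symm, hI'.1], h⟩)
      exact heI (Or.inr hmem)
    rw [← hI.encard_eq_eRk, ← hb.encard_eq_eRk, Set.encard_insert_of_notMem hI'.1]

/-- Together with `exists_projection` this is the lift property. The tip is spanned by a pair on one
leg and by a transversal outside `𝒟`, which is a base. If `X` has only cycles in `𝒟`, then either it
misses a leg and is independent with the tip, or it is a transversal in `𝒟`. In the latter case it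
is spanned by `X` minus one element, which is independent with the tip. -/
theorem eRk_insert_none (hM : IsSpikeMatroid 𝒟 M) (hr : 2 ≤ r) (X : Set (SpikeElt r)) :
    ((∀ C ⊆ X, IsSpikeCycle C → C ∈ 𝒟) → M.eRk (insert none X) = M.eRk X + 1) ∧
    ((¬ ∀ C ⊆ X, IsSpikeCycle C → C ∈ 𝒟) → M.eRk (insert none X) = M.eRk X) := by
  constructor
  · intro h
    refine Matroid.eRk_insert_eq_add_one ⟨hM.mem_ground _, ?_⟩
    have hn : none ∉ X := fun hn =>
      (hM.isTransversal _ (h {none} (by simpa using hn) (Or.inl rfl))).1 rfl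
    have hp : ∀ i, ¬ (some (i, false) ∈ X ∧ some (i, true) ∈ X) := by
      rintro i ⟨hf, ht⟩
      have := hM.isTransversal _ (h {some (i, false), some (i, true)}
        (by rintro _ (rfl | rfl) <;> assumption) (Or.inr (Or.inl ⟨i, rfl⟩)))
      exact absurd ((this.2 i).unique (y₁ := false) (y₂ := true) (by simp) (by simp)) (by simp)
    by_cases hX : legIndices X = Set.univ
    · have hT := isTransversal_of_legIndices_eq hn hp hX
      have hX𝒟 := h X subset_rfl (Or.inr (Or.inr hT))
      obtain ⟨b, hb, hb'⟩ := hT.2 ⟨0, by omega⟩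
      set e : SpikeElt r := some (⟨0, by omega⟩, b)
      have hI : M.Indep (insert none (X \ {e})) := by
        refine hM.indep_insert_none (fun h => hn h.1) (fun i h => hp i ⟨h.1.1, h.2.1⟩) fun hu => ?_
        obtain ⟨c, hc, hce⟩ : (⟨0, by omega⟩ : Fin r) ∈ legIndices (X \ {e}) :=
          hu ▸ Set.mem_univ _
        exact hce (by rw [hb' c hc]; rfl)
      have hI' : M.Indep (X \ {e}) := hI.subset (Set.subset_insert _ _)
      have hXe : insert e (X \ {e}) = X := by simp [Set.insert_eq_of_mem hb]
      have hdep : ¬ M.Indep X := by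
        intro hXi
        obtain ⟨B, hB, hXB⟩ := hXi.exists_isBase_superset
        have hB' := (hM.isBase_iff B).1 hB
        have : X = B := Set.eq_of_subset_of_ncard_le hXB (by rw [hB'.1, hT.ncard_eq])
        exact hB'.2.2 (this ▸ hX𝒟)
      have hecl : e ∈ M.closure (X \ {e}) := by
        rw [hI'.mem_closure_iff_of_notMem (by simp), hXe]
        exact ⟨hdep, hM.subset_ground _⟩
      rw [← hXe, Matroid.closure_insert_eq_of_mem_closure hecl]
      exact (hI'.notMem_closure_iff_of_notMem (fun h => hn h.1) (hM.mem_ground _)).2 hI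
    · have hI := hM.indep_insert_none hn hp hX
      exact ((hI.subset (Set.subset_insert _ _)).notMem_closure_iff_of_notMem hn
        (hM.mem_ground _)).2 hI
  · intro h
    push Not at h
    obtain ⟨C, hCX, hC, hC𝒟⟩ := h
    have hcl : none ∈ M.closure X := by
      refine M.closure_subset_closure hCX ?_
      rcases hC with rfl | ⟨i, rfl⟩ | hC
      · exact M.mem_closure_of_mem' rfl (hM.mem_ground _)
      · rw [(hM.indep_pair hr i).mem_closure_iff_of_notMem (by simp)]
        refine ⟨fun hI => ?_, hM.subset_ground _⟩
        have hc := hM.ncard_le_of_indep hI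
        have hidx : legIndices {none, some (i, false), some (i, true)} = {i} := by
          ext j; simp [legIndices]
        rw [hidx, Set.ncard_insert_of_notMem (by simp), Set.ncard_pair (by simp)] at hc
        simp at hc
      · have hB : M.IsBase C := (hM.isBase_iff C).2 ⟨hC.ncard_eq, by
          rw [hC.legIndices_eq]; simp, hC𝒟⟩
        rw [hB.closure_eq]
        exact hM.mem_ground _
    rw [← Matroid.eRk_insert_closure_eq, Set.insert_eq_of_mem hcl, Matroid.eRk_closure_eq]

end IsSpikeMatroid

end GainMatroid

/-! ### The doubled cycle with a loop, and its cycles. -/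

namespace GainMatroid

section SpikeGraph

variable {r : ℕ}

/-- The successor of `i` in the cyclic order of `0, …, r - 1`. -/
def cyclicSucc (r i : ℕ) : ℕ := if i + 1 < r then i + 1 else 0

theorem cyclicSucc_lt (hr : 3 ≤ r) (i : ℕ) : cyclicSucc r i < r := by
  unfold cyclicSucc; split <;> omega

theorem cyclicSucc_ne (hr : 3 ≤ r) (i : Fin r) : cyclicSucc r i ≠ i := by
  unfold cyclicSucc; split <;> omega

theorem cyclicSucc_injective {i j : Fin r} (h : cyclicSucc r i = cyclicSucc r j) : i = j := by
  unfold cyclicSucc at h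
  ext
  split at h <;> split at h <;> omega

/-- A cycle of length `r` with every edge doubled, and a loop at one vertex. -/
def spikeGraph (r : ℕ) (hr : 3 ≤ r) : Graph ℕ (SpikeElt r) where
  vertexSet := {n | n < r}
  IsLink e x y := match e with
    | none => x = 0 ∧ y = 0
    | some (i, _) => (x = i ∧ y = cyclicSucc r i) ∨ (x = cyclicSucc r i ∧ y = i)
  isLink_symm := by
    rintro (_ | ⟨i, b⟩) -
    · exact ⟨fun _ _ h => ⟨h.2, h.1⟩⟩
    · exact ⟨fun _ _ h => h.symm.imp And.symm And.symm⟩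
  eq_or_eq_of_isLink_of_isLink := by
    rintro (_ | ⟨i, b⟩) <;> dsimp only <;> omega
  left_mem_of_isLink := by
    have := cyclicSucc_lt hr
    rintro (_ | ⟨i, b⟩) x y h <;> dsimp only [Set.mem_ofPred_eq] at h ⊢
    · omega
    · have := cyclicSucc_lt hr i
      have := i.isLt
      omega

variable {hr : 3 ≤ r}

theorem spikeGraph_isLink_none {x y : ℕ} :
    (spikeGraph r hr).IsLink none x y ↔ x = 0 ∧ y = 0 := Iff.rfl

theorem spikeGraph_isLink_some {i : Fin r} {b : Bool} {x y : ℕ} :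
    (spikeGraph r hr).IsLink (some (i, b)) x y ↔
      (x = i ∧ y = cyclicSucc r i) ∨ (x = cyclicSucc r i ∧ y = i) := Iff.rfl

theorem spikeGraph_edgeSet : E(spikeGraph r hr) = Set.univ := by
  refine Set.eq_univ_of_forall ?_
  rintro (_ | ⟨i, b⟩)
  · exact (spikeGraph_isLink_none.2 ⟨rfl, rfl⟩ : (spikeGraph r hr).IsLink _ _ _).edge_mem
  · exact (spikeGraph_isLink_some.2 (Or.inl ⟨rfl, rfl⟩) : (spikeGraph r hr).IsLink _ _ _).edge_mem

/-- For `k = r - 1`, the remaining edge between `r - 1` and `0` closes this path to the cycle of the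
transversal `s`. -/
theorem exists_descending_path (s : Fin r → Bool) : ∀ k, k < r →
    ∃ p : GWalk (spikeGraph r hr) k 0, p.IsPath ∧ (∀ n ∈ p.support, n ≤ k) ∧
      ∀ e, e ∈ p.edges ↔ ∃ i : Fin r, (i : ℕ) < k ∧ e = some (i, s i)
  | 0, hk => ⟨.nil hk, by simp [GWalk.IsPath, GWalk.support], by simp [GWalk.support],
      by simp [GWalk.edges]⟩
  | k + 1, hk => by
    obtain ⟨p, hp, hs, he⟩ := exists_descending_path s k (by omega)
    have hl : (spikeGraph r hr).IsLink (some (⟨k, by omega⟩, s ⟨k, by omega⟩)) (k + 1) k :=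
      spikeGraph_isLink_some.2 (Or.inr ⟨by simp [cyclicSucc, hk], rfl⟩)
    refine ⟨.cons _ hl p, ?_, ?_, ?_⟩
    · simp only [GWalk.IsPath, GWalk.support, List.nodup_cons]
      exact ⟨fun h => by have := hs _ h; omega, hp⟩
    · simp only [GWalk.support, List.mem_cons]
      rintro n (rfl | h)
      · rfl
      · exact (hs n h).trans (by omega)
    · intro e
      simp only [GWalk.edges, List.mem_cons, he]
      constructor
      · rintro (rfl | ⟨i, hi, rfl⟩)
        · exact ⟨⟨k, by omega⟩, by simp, rfl⟩
        · exact ⟨i, by omega, rfl⟩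
      · rintro ⟨i, hi, rfl⟩
        by_cases hik : (i : ℕ) = k
        · subst hik; exact Or.inl rfl
        · exact Or.inr ⟨i, by omega, rfl⟩

theorem IsSpikeCycle.isCycleSet {C : Set (SpikeElt r)} (hC : IsSpikeCycle C) :
    IsCycleSet (spikeGraph r hr) C := by
  rcases hC with rfl | ⟨i, rfl⟩ | hC
  · exact isCycleSet_loop (x := 0) (spikeGraph_isLink_none.2 ⟨rfl, rfl⟩)
  · exact isCycleSet_digon (spikeGraph_isLink_some.2 (Or.inl ⟨rfl, rfl⟩))
      (spikeGraph_isLink_some.2 (Or.inl ⟨rfl, rfl⟩)) (by simp) (cyclicSucc_ne hr i).symm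
  · obtain ⟨s, rfl⟩ := hC.exists_eq
    obtain ⟨p, hp, -, he⟩ := exists_descending_path (hr := hr) s (r - 1) (by omega)
    have hl : (spikeGraph r hr).IsLink (some (⟨r - 1, by omega⟩, s ⟨r - 1, by omega⟩)) 0 (r - 1) :=
      spikeGraph_isLink_some.2 (Or.inr ⟨by simp only [cyclicSucc]; split <;> omega, rfl⟩)
    refine ⟨0, .cons _ hl p, ⟨by simp [GWalk.edges], ?_, hp⟩, ?_⟩
    · simp only [GWalk.edges, List.nodup_cons, he]
      refine ⟨?_, hp.edges_nodup⟩
      rintro ⟨i, hi, h⟩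
      simp only [Option.some.injEq, Prod.mk.injEq] at h
      rw [← h.1] at hi
      simp at hi
    · ext e
      simp only [GWalk.edgeSet, GWalk.edges, List.mem_cons, he, Set.mem_range, Set.mem_ofPred_eq]
      constructor
      · rintro (rfl | ⟨i, -, rfl⟩) <;> exact ⟨_, rfl⟩
      · rintro ⟨i, rfl⟩
        by_cases hi : (i : ℕ) = r - 1
        · left
          have : i = ⟨r - 1, by omega⟩ := Fin.ext hi
          rw [this]
        · exact Or.inr ⟨i, by omega, rfl⟩

/-- Without the loop and without parallel pairs, an edge of index `i` can continue at its far end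
only by an edge of the next index, so `C` runs around the whole cycle. -/
theorem NoPendant.exists_isSpikeCycle {C : Set (SpikeElt r)} (hC : NoPendant (spikeGraph r hr) C)
    (hne : C.Nonempty) : ∃ D ⊆ C, IsSpikeCycle D := by
  by_contra! hcon
  have hnot := mt (exists_isSpikeCycle_subset (X := C)) (by push Not; exact hcon)
  push Not at hnot
  obtain ⟨hn, hp, hidx⟩ := hnot
  have hstep : ∀ i ∈ legIndices C, ∀ j : Fin r, (j : ℕ) = cyclicSucc r i → j ∈ legIndices C := by
    rintro i ⟨b, hb⟩ j hj
    obtain ⟨f, hf, hfe, y, hfy⟩ := hC _ hb (cyclicSucc r i)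
      ⟨i, (cyclicSucc_ne hr i).symm, spikeGraph_isLink_some.2 (Or.inr ⟨rfl, rfl⟩)⟩
    rcases f with _ | ⟨k, c⟩
    · exact absurd hf hn
    rcases spikeGraph_isLink_some.1 hfy with ⟨h, -⟩ | ⟨h, -⟩
    · have : j = k := Fin.ext (hj.trans h)
      exact ⟨c, this ▸ hf⟩
    · obtain rfl := cyclicSucc_injective h
      have := hp i
      cases b <;> cases c <;> simp_all
  obtain ⟨i₀, hi₀⟩ : (legIndices C).Nonempty := by
    obtain ⟨_ | ⟨i, b⟩, he⟩ := hne
    · exact absurd he hn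
    · exact ⟨i, b, he⟩
  have hup : ∀ (a : Fin r), a ∈ legIndices C → ∀ n, (h : a + n < r) →
      (⟨a + n, h⟩ : Fin r) ∈ legIndices C := by
    intro a ha n
    induction n with
    | zero => intro _; exact ha
    | succ n ih =>
      intro h
      refine hstep _ (ih (by omega)) _ ?_
      simp only [cyclicSucc]
      rw [if_pos (by omega)]
      rfl
  -- Go up from `i₀` to `r - 1`, step around to `0`, and go up again to reach every index.
  have hlast := hup i₀ hi₀ (r - 1 - i₀) (by omega)
  have hzero : (⟨0, by omega⟩ : Fin r) ∈ legIndices C := by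
    refine hstep _ hlast _ ?_
    simp only [cyclicSucc]
    rw [if_neg (by omega)]
  refine hidx (Set.eq_univ_of_forall fun j => ?_)
  have := hup _ hzero j (by simp)
  simpa using this

theorem IsCycleSet.isSpikeCycle {C : Set (SpikeElt r)} (hC : IsCycleSet (spikeGraph r hr) C) :
    IsSpikeCycle C := by
  obtain ⟨D, hDC, hD⟩ := hC.noPendant.exists_isSpikeCycle hC.nonempty
  rwa [← hC.eq_of_noPendant (hD.isCycleSet (hr := hr)).noPendant
    (hD.isCycleSet (hr := hr)).nonempty hDC]

end SpikeGraph

/-! ### Gains on the doubled cycle, and the realization of spikes. -/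

section SpikeGain

variable {Γ : Type w} [Group Γ] {r : ℕ} {hr : 3 ≤ r} {γ : Γ}

/-- The gain function on `spikeGraph` in which the tip and one edge of each parallel pair have
gain `γ` and all other edges have gain `1`. -/
def spikeGain (r : ℕ) (hr : 3 ≤ r) (γ : Γ) : GainFunction (spikeGraph r hr) Γ where
  val e x _ := match e with
    | none => γ
    | some (_, false) => 1
    | some (i, true) => if x = i then γ else γ⁻¹
  val_reverse := by
    rintro (_ | ⟨i, _ | _⟩) x y h hxy
    · exact absurd (h.1.trans h.2.symm) hxy
    · simp
    · have := cyclicSucc_ne hr i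
      rcases spikeGraph_isLink_some.1 h with ⟨rfl, rfl⟩ | ⟨rfl, rfl⟩ <;> simp [this]

theorem spikeGain_mem (Γ₁ : Subgroup Γ) (hγ : γ ∈ Γ₁) (e : SpikeElt r) (x y : ℕ) :
    (spikeGain r hr γ).val e x y ∈ Γ₁ := by
  rcases e with _ | ⟨i, _ | _⟩
  · exact hγ
  · exact Γ₁.one_mem
  · simp only [spikeGain]
    split
    exacts [hγ, Γ₁.inv_mem hγ]

/-- All gains vanish modulo `Γ₁`, so every cycle is balanced and no handcuff or theta is a circuit.
-/
theorem spikeGain_isFrameCircuit_quot_iff (Γ₁ : Subgroup Γ) [Γ₁.Normal] (hγ : γ ∈ Γ₁)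
    {C : Set (SpikeElt r)} :
    ((spikeGain r hr γ).quot Γ₁).IsFrameCircuit C ↔ IsSpikeCycle C := by
  have hbal : ∀ {D : Set (SpikeElt r)}, IsSpikeCycle D →
      ((spikeGain r hr γ).quot Γ₁).IsBalancedCycle D := by
    intro D hD
    obtain ⟨x, p, hp, hpD⟩ := hD.isCycleSet (hr := hr)
    exact ⟨x, p, hp, hpD, GainFunction.walkGain_quot_eq_one Γ₁ (spikeGain_mem Γ₁ hγ) p⟩
  refine ⟨fun h => ?_, fun h => Or.inl (hbal h)⟩
  obtain ⟨D, hDC, hD⟩ := h.noPendant.exists_isSpikeCycle h.nonempty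
  rcases h with h | ⟨-, h⟩
  · exact h.isCycleSet.isSpikeCycle
  · exact absurd (hbal hD) (h D hDC hD.isCycleSet)

theorem spikeGain_linearClass_iff (Γ₁ : Subgroup Γ) [Γ₁.Normal] (𝒜 : Set (Subgroup Γ))
    (hγ : γ ∈ Γ₁) {C : Set (SpikeElt r)} (hC : IsSpikeCycle C) :
    C ∈ (spikeGain r hr γ).linearClass Γ₁ 𝒜 ↔ (spikeGain r hr γ).IsBalancedCycle C := by
  constructor
  · rintro ⟨-, h | ⟨h | h, -⟩⟩
    · exact h
    · exact absurd h (hC.isCycleSet (hr := hr)).not_isHandcuff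
    · exact absurd h (hC.isCycleSet (hr := hr)).not_isTheta
  · exact fun h => ⟨(spikeGain_isFrameCircuit_quot_iff Γ₁ hγ).2 hC, Or.inl h⟩

theorem spikeGain_not_balanced_tip (hγ : γ ≠ 1) :
    ¬ (spikeGain r hr γ).IsBalancedCycle {none} := by
  intro h
  refine hγ (h.eq_one_of_potential rfl (fun _ => 1) (fun a b _ => ⟨γ, Or.inl rfl, ?_⟩) ?_)
  · simp [spikeGain]
  · intro e he hne; exact absurd he hne

theorem spikeGain_not_balanced_pair (hγ : γ ≠ 1) (i : Fin r) :
    ¬ (spikeGain r hr γ).IsBalancedCycle {some (i, false), some (i, true)} := by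
  intro h
  refine hγ (h.eq_one_of_potential (e₀ := some (i, true)) (by simp) (fun _ => 1) ?_ ?_)
  · intro a b hab
    refine ⟨_, ?_, by simp only [inv_one, one_mul, mul_one]; rfl⟩
    simp only [spikeGain]
    split
    exacts [Or.inl rfl, Or.inr rfl]
  · rintro e (rfl | rfl) hne a b -
    · simp [spikeGain]
    · exact absurd rfl hne

open Classical in
/-- The indicator of the indices at which `T` uses the edge with nontrivial gain. -/
noncomputable def upperIndicator (T : Set (SpikeElt r)) (i : ℕ) : ℕ :=
  if ∃ h : i < r, some (⟨i, h⟩, true) ∈ T then 1 else 0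

theorem upperIndicator_coe_true {T : Set (SpikeElt r)} {i : Fin r} (h : some (i, true) ∈ T) :
    upperIndicator T i = 1 := if_pos ⟨i.2, h⟩

theorem upperIndicator_coe_false {T : Set (SpikeElt r)} (hT : IsTransversal T) {i : Fin r}
    (h : some (i, false) ∈ T) : upperIndicator T i = 0 :=
  if_neg fun ⟨_, h'⟩ => absurd ((hT.2 i).unique h h') (by simp)

/-- The partial sums of the exponents give a potential `γ ^ S k` for all edges of `T` but the last,
which is left with the total gain of the cycle. -/
theorem IsTransversal.pow_sum_eq_one {T : Set (SpikeElt r)} (hT : IsTransversal T)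
    (hb : (spikeGain r hr γ).IsBalancedCycle T) :
    γ ^ (∑ i ∈ Finset.range r, upperIndicator T i) = 1 := by
  let S : ℕ → ℕ := fun k => ∑ i ∈ Finset.range k, upperIndicator T i
  have hS : ∀ k, S (k + 1) = S k + upperIndicator T k := fun k => Finset.sum_range_succ _ _
  have hfwd : ∀ (i : Fin r) (b : Bool), some (i, b) ∈ T →
      (spikeGain r hr γ).val (some (i, b)) i (cyclicSucc r i) = γ ^ upperIndicator T i := by
    rintro i (_ | _) h
    · rw [upperIndicator_coe_false hT h]; simp [spikeGain]
    · rw [upperIndicator_coe_true h]; simp [spikeGain]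
  have hbwd : ∀ (i : Fin r) (b : Bool), some (i, b) ∈ T →
      (spikeGain r hr γ).val (some (i, b)) (cyclicSucc r i) i = (γ ^ upperIndicator T i)⁻¹ := by
    intro i b h
    rw [← hfwd i b h]
    exact (spikeGain r hr γ).val_reverse _ _ _
      (spikeGraph_isLink_some.2 (Or.inr ⟨rfl, rfl⟩)) (cyclicSucc_ne hr i)
  let l : Fin r := ⟨r - 1, by omega⟩
  obtain ⟨b, hbT, huniq⟩ := hT.2 l
  have hl : cyclicSucc r l = 0 := by simp only [cyclicSucc, l]; rw [if_neg (by omega)]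
  have hlast : S r = S l + upperIndicator T l := by
    rw [← hS]; congr 1; simp only [l]; omega
  have h0 : S 0 = 0 := Finset.sum_range_zero _
  refine hb.eq_one_of_potential hbT (fun k => γ ^ S k) ?_ ?_
  · intro x y hxy
    change ∃ δ, (δ = γ ^ S r ∨ δ = (γ ^ S r)⁻¹) ∧ _
    rcases spikeGraph_isLink_some.1 hxy with ⟨rfl, rfl⟩ | ⟨rfl, rfl⟩
    · refine ⟨_, Or.inl rfl, ?_⟩
      rw [hfwd l b hbT, hl, h0, hlast, pow_add]
      group
    · refine ⟨_, Or.inr rfl, ?_⟩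
      rw [hbwd l b hbT, hl, h0, hlast, pow_add, (Commute.pow_pow_self γ _ _).eq]
      group
  · rintro (_ | ⟨i, c⟩) he hne x y hxy
    · exact absurd he hT.1
    have hil : i ≠ l := by
      rintro rfl
      exact hne (by rw [huniq c he])
    have hi : cyclicSucc r i = i + 1 := by
      have : (i : ℕ) ≠ r - 1 := fun h => hil (Fin.ext h)
      simp only [cyclicSucc]; rw [if_pos (by omega)]
    rcases spikeGraph_isLink_some.1 hxy with ⟨rfl, rfl⟩ | ⟨rfl, rfl⟩
    · rw [hfwd i c he, hi, hS, pow_add]; group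
    · rw [hbwd i c he, hi, hS, pow_add]; group

/-- Two balanced transversals do not differ in exactly one element. -/
theorem spikeGain_eq_of_balanced (hγ : γ ≠ 1) {I : Set (SpikeElt r)} {e f : SpikeElt r}
    (heI : e ∉ I) (hfI : f ∉ I) (he : IsTransversal (insert e I))
    (hf : IsTransversal (insert f I)) (hbe : (spikeGain r hr γ).IsBalancedCycle (insert e I))
    (hbf : (spikeGain r hr γ).IsBalancedCycle (insert f I)) : e = f := by
  classical
  rcases e with _ | ⟨j, b⟩
  · exact absurd (Set.mem_insert _ _) he.1
  rcases f with _ | ⟨k, c⟩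
  · exact absurd (Set.mem_insert _ _) hf.1
  have hjk : j = k := by
    obtain ⟨d, hd, -⟩ := hf.2 j
    rcases hd with hd | hd
    · simpa using congrArg (Option.map Prod.fst) hd
    · have := (he.2 j).unique (Or.inr hd) (Set.mem_insert _ _)
      exact absurd (this ▸ hd) heI
  subst hjk
  -- The two exponents of `γ` differ by exactly one, so if both powers are trivial then `γ = 1`.
  have key : IsTransversal (insert (some (j, true)) I) → IsTransversal (insert (some (j, false)) I) →
      (spikeGain r hr γ).IsBalancedCycle (insert (some (j, true)) I) →
      (spikeGain r hr γ).IsBalancedCycle (insert (some (j, false)) I) → False := by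
    intro ht hf hbt hbf
    have hsum : ∀ i, upperIndicator (insert (some (j, true)) I) i =
        upperIndicator (insert (some (j, false)) I) i + if i = (j : ℕ) then 1 else 0 := by
      intro i
      by_cases hi : i = (j : ℕ)
      · subst hi
        rw [upperIndicator_coe_true (Set.mem_insert _ _),
          upperIndicator_coe_false hf (Set.mem_insert _ _), if_pos rfl]
      · rw [if_neg hi]
        have hij : ∀ h : i < r, (⟨i, h⟩ : Fin r) ≠ j := fun h h' => hi (congrArg Fin.val h')
        simp [upperIndicator, hij]
    have h1 := ht.pow_sum_eq_one hbt
    have h2 := hf.pow_sum_eq_one hbf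
    simp only [hsum, Finset.sum_add_distrib, Finset.sum_ite_eq', Finset.mem_range, j.isLt,
      if_true] at h1
    rw [pow_succ, h2, one_mul] at h1
    exact hγ h1
  cases b <;> cases c
  · rfl
  · exact (key hf he hbf hbe).elim
  · exact (key he hf hbe hbf).elim
  · rfl

theorem matroidIso_refl {α : Type u} (M : Matroid α) : MatroidIso M M := by
  refine ⟨Equiv.refl _, Matroid.ext_indep rfl fun I hI => ?_⟩
  rw [Matroid.mapSetEquiv_indep_iff]
  have : (Subtype.val '' ((Equiv.refl M.E).symm '' (Subtype.val ⁻¹' I : Set M.E))) = I := by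
    simpa using hI
  rw [this]
  exact and_iff_left hI

/-- The spike is built abstractly, with the balanced transversals as its dependent ones, and then
recognized as the lift of its projection from the tip, which is the frame matroid of the quotient
gains. -/
theorem exists_isSpike_inClass (Γ₁ : Subgroup Γ) [Γ₁.Normal] (𝒜 : Set (Subgroup Γ))
    (hΓ₁ : Γ₁ ≠ ⊥) {r : ℕ} (hr : 3 ≤ r) :
    ∃ (α : Type) (M : Matroid α), IsSpike r M ∧ InClass Γ₁ 𝒜 M := by
  obtain ⟨γ, hγ, hγ1⟩ := Γ₁.bot_or_exists_ne_one.resolve_left hΓ₁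
  let ψ := spikeGain r hr γ
  obtain ⟨M, hM⟩ := exists_isSpikeMatroid (r := r)
    (𝒟 := {T | IsTransversal T ∧ ψ.IsBalancedCycle T}) (by omega) (fun T hT => hT.1)
    (fun I e f he hf h₁ h₂ => spikeGain_eq_of_balanced hγ1 he hf h₁.1 h₂.1 h₁.2 h₂.2)
  obtain ⟨N, hNE, hNI, hNr⟩ := hM.exists_projection (by omega)
  have hcirc : ∀ C, N.IsCircuit C ↔ IsSpikeCycle C := by
    intro C
    have hdep : ∀ X, N.Dep X ↔ ∃ D ⊆ X, IsSpikeCycle D := by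
      intro X
      rw [← Matroid.not_indep_iff (hNE ▸ Set.subset_univ X), hNI]
      push Not
      rfl
    rw [Matroid.isCircuit_iff]
    constructor
    · rintro ⟨h, hmin⟩
      obtain ⟨D, hDC, hD⟩ := (hdep C).1 h
      exact hmin ((hdep D).2 ⟨D, subset_rfl, hD⟩) hDC ▸ hD
    · intro hC
      refine ⟨(hdep C).2 ⟨C, subset_rfl, hC⟩, fun D hD hDC => hDC.antisymm ?_⟩
      obtain ⟨K, hKD, hK⟩ := (hdep D).1 hD
      have hK' := hK.isCycleSet (hr := hr)
      rw [← (hC.isCycleSet (hr := hr)).eq_of_noPendant hK'.noPendant hK'.nonempty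
        (hKD.trans hDC)]
      exact hKD
  have hclass : ∀ C, IsSpikeCycle C →
      (C ∈ ψ.linearClass Γ₁ 𝒜 ↔ C ∈ {T | IsTransversal T ∧ ψ.IsBalancedCycle T}) := by
    intro C hC
    rw [spikeGain_linearClass_iff Γ₁ 𝒜 hγ hC, Set.mem_ofPred_eq, iff_and_self]
    intro hb
    rcases hC with rfl | ⟨i, rfl⟩ | hC
    · exact absurd hb (spikeGain_not_balanced_tip hγ1)
    · exact absurd hb (spikeGain_not_balanced_pair hγ1 i)
    · exact hC
  refine ⟨SpikeElt r, M, hM.isSpike hr, ℕ, SpikeElt r, spikeGraph r hr, ψ, M,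
    Set.finite_lt_nat r, Set.toFinite _, ⟨N, ⟨?_, fun C => ?_⟩, ?_, fun X _ => ?_⟩,
    matroidIso_refl M⟩
  · rw [hNE, spikeGraph_edgeSet]
  · rw [hcirc, spikeGain_isFrameCircuit_quot_iff Γ₁ hγ]
  · rw [hM.ground_eq, hNE]
  · have hiff : (∀ C ⊆ X, N.IsCircuit C → C ∈ ψ.linearClass Γ₁ 𝒜) ↔
        ∀ C ⊆ X, IsSpikeCycle C → C ∈ {T | IsTransversal T ∧ ψ.IsBalancedCycle T} := by
      refine forall₂_congr fun C _ => ?_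
      rw [hcirc]
      exact forall_congr' fun hC => hclass C hC
    rw [hiff]
    have h := hM.eRk_insert_none (by omega) X
    -- Both rank formulas now speak of `N.eRk X + 1`: it equals `M.eRk X + 1` if all circuits in `X`
    -- are in the class, and `M.eRk X` otherwise.
    rw [← hNr X] at h
    exact ⟨fun hX => (WithTop.add_right_cancel ENat.one_ne_top (h.1 hX)).symm,
      fun hX => (h.2 hX).symm⟩

end SpikeGain

end GainMatroid

theorem mainTheorem9 {Γ : Type w} [Group Γ] (Γ₁ : Subgroup Γ) [Γ₁.Normal]
    (𝒜 : Set (Subgroup Γ)) (hpart : GainMatroid.IsFrobeniusPartition Γ₁ 𝒜) (hΓ₁ : Γ₁ ≠ ⊥) :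
    (¬ ∀ (α β : Type) (M : Matroid α) (N : Matroid β),
      GainMatroid.InClass Γ₁ 𝒜 M → GainMatroid.InClass Γ₁ 𝒜 N →
        GainMatroid.InClass Γ₁ 𝒜 (M.sum N)) ∧
    (∀ r : ℕ, 3 ≤ r → ∃ (α : Type) (M : Matroid α),
      GainMatroid.IsSpike r M ∧ GainMatroid.InClass Γ₁ 𝒜 M) ∧
    (∀ r : ℕ, 5 ≤ r → ∀ (α : Type u) (M : Matroid α),
      GainMatroid.IsSpike r M → GainMatroid.InClass Γ₁ 𝒜 M →
        ¬ GainMatroid.InClass Γ₁ 𝒜 (M.sum M)) := by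
  refine ⟨fun h => ?_, fun r hr => GainMatroid.exists_isSpike_inClass Γ₁ 𝒜 hΓ₁ hr,
    fun r hr α M hM _ => hM.not_inClass_sum Γ₁ 𝒜 hr⟩
  -- Five is the least rank to which the exclusion of `M ⊕ M` applies.
  obtain ⟨α, M, hM, hMc⟩ := GainMatroid.exists_isSpike_inClass Γ₁ 𝒜 hΓ₁ (r := 5) (by norm_num)
  exact hM.not_inClass_sum Γ₁ 𝒜 le_rfl (h α α M M hMc hMc)
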